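/- Let $\mathbb I=[0,1]$, and let $\mathbb U$ be the monoid (under composition, ordered pointwise) of complete lattice homomorphisms $\mathbb I\to\mathbb I$, i.e. of monotone surjections $\mathbb I\to\mathbb I$; write $r\dotplus s=\min(r+s,1)$. A *$\mathbb U$-poset* is a poset $A$ with an action of $\mathbb U$ that is monotone in both variables. In a $\mathbb U$-poset, for $r\in\mathbb I$ and $a,b\in A$, write $a\le_r b$ if for all $u,v\in\mathbb U$ such that $u(t\dotplus r)\le v(t)$ for all $t\in\mathbb I$, we have $u(a)\le v(b)$. Put $\rho(a,b)=\inf\{r\in\mathbb I: a\le_r b\}$ and $d(a,b)=\max(\rho(a,b),\rho(b,a))$. The $\mathbb U$-poset $A$ is *Archimedean* if $a\le b$ whenever $a\le_r b$ for all $r>0$; it is *complete* if it is Archimedean and every $d$-Cauchy sequence in $A$ $d$-converges in $A$. It is *stackable* if for all $0<r<1$ and all $u,v\in\mathbb U$ restricting to order-isomorphisms $u:[0,r]\cong[0,1]$ and $v:[r,1]\cong[0,1]$: 1. for $a,b\in A$, if $u(a)\le u(b)$ and $v(a)\le v(b)$ then $a\le b$; and 2. for $a,b\in A$ such that $v'(b)\le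 u'(a)$ for all $u',v'\in\mathbb U$, there is a (unique) $c\in A$ with $u(c)=a$ and $v(c)=b$. A *$\mathbb U$-meet-semilattice* is a $\mathbb U$-poset with finite meets (including a top element) that are preserved by the action of each $u\in\mathbb U$; morphisms are the $\mathbb U$-equivariant maps preserving finite meets. A *continuous lattice* is a complete lattice in which every element $x$ is the join of an ideal (nonempty directed lower set) of elements way below $x$, where $y\ll x$ means that $y$ belongs to every ideal whose join is $\ge x$; morphisms are the maps preserving arbitrary meets and (nonempty) directed joins. **Statement.** For every continuous lattice $X$, the set $\mathrm{CtsLat}(X,\mathbb I)$ of morphisms $X\to\mathbb I$, with the pointwise order, finite meets and $\mathbb U$-action, is a complete stackable $\mathbb U$-meet-semilattice. For every complete stackable $\mathbb U$-meet-semilattice $A$, the set of morphisms $A\to\mathbb I$ of $\mathbb U$-meet-semilattices, with the pointwise order, is a continuous lattice. The resulting contravariant functors $\mathrm{Hom}(-,\mathbb I)$ (acting on morphisms by precomposition) form a dual adjunction whose unit and counit are the evaluation maps $x\mapsto(f\mapsto f(x))$ and $a\mapsto(f\mapsto f(a))$, and this adjunction is a dual equivalence between the category of continuous lattices and the category of complete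 stackable $\mathbb U$-meet-semilattices (with the morphisms above). -/

import Mathlib

open CategoryTheory Opposite

universe u v w

namespace CtsDuality

/-! ### The unit interval and the monoid `U` of its complete lattice endomorphisms -/

/-- The unit interval `[0,1]`. -/
abbrev II : Type := ↥unitInterval

/-- `U` is the set of complete lattice homomorphisms `[0,1] → [0,1]`, i.e. maps preserving
arbitrary (also empty) joins and meets. -/
def U : Type := CompleteLatticeHom II II

namespace U

instance : FunLike U II II := inferInstanceAs (FunLike (CompleteLatticeHom II II) II II)

instance : CompleteLatticeHomClass U II II :=
  inferInstanceAs (CompleteLatticeHomClass (CompleteLatticeHom II II) II II)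

/-- The pointwise order. -/
instance : PartialOrder U := PartialOrder.lift (fun p : U => (p : II → II)) DFunLike.coe_injective

/-- The monoid structure: multiplication is composition. -/
noncomputable instance : Monoid U where
  mul p q := CompleteLatticeHom.comp p q
  one := CompleteLatticeHom.id II
  mul_assoc _ _ _ := rfl
  one_mul _ := rfl
  mul_one _ := rfl

theorem le_def {p q : U} : p ≤ q ↔ ∀ t, p t ≤ q t := Iff.rfl

theorem mul_apply (p q : U) (t : II) : (p * q) t = p (q t) := rfl

theorem one_apply (t : II) : (1 : U) t = t := rfl

theorem monotone (p : U) : Monotone p := OrderHomClass.mono p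

theorem scottContinuous (p : U) : ScottContinuous (p : II → II) := by
  intro d _ _ a ha
  rw [← ha.sSup_eq, map_sSup]
  exact isLUB_sSup _

end U

/-- Truncated addition `r ∔ s = min (r + s) 1` on `[0,1]`. -/
noncomputable def tadd (r s : II) : II :=
  ⟨min ((r : ℝ) + s) 1, le_min (add_nonneg r.2.1 s.2.1) zero_le_one, min_le_right _ _⟩

/-! ### `U`-posets -/

/-- A `U`-poset: a poset with an action of the monoid `U`, monotone in both variables. -/
class UPoset (A : Type u) [PartialOrder A] extends MulAction U A where
  smul_mono_left : ∀ {p q : U}, p ≤ q → ∀ a : A, p • a ≤ q • a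
  smul_mono_right : ∀ (p : U) {a b : A}, a ≤ b → p • a ≤ p • b

section UPoset

variable {A : Type u} [PartialOrder A] [UPoset A]

/-- The relation `a ≤_r b` (intuitively `a ≤ b ∔ r`). -/
def LeR (r : II) (a b : A) : Prop :=
  ∀ p q : U, (∀ t : II, p (tadd t r) ≤ q t) → p • a ≤ q • b

/-- The pseudoquasimetric `ρ(a, b)`; the infimum is taken in `[0,1]`. -/
noncomputable def rho (a b : A) : II := sInf {r : II | LeR r a b}

/-- The symmetrized pseudometric `dist(a, b) = ρ(a, b) ∨ ρ(b, a)`. -/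
noncomputable def udist (a b : A) : II := rho a b ⊔ rho b a

variable (A)

/-- `A` is Archimedean. -/
def IsArchimedean : Prop := ∀ a b : A, (∀ r : II, 0 < r → LeR r a b) → a ≤ b

/-- `A` is (Cauchy-)complete: Archimedean, and every Cauchy sequence for `dist` converges. -/
def IsCauchyComplete : Prop :=
  IsArchimedean A ∧
    ∀ s : ℕ → A,
      (∀ ε : II, 0 < ε → ∃ N, ∀ m ≥ N, ∀ n ≥ N, udist (s m) (s n) < ε) →
      ∃ a : A, ∀ ε : II, 0 < ε → ∃ N, ∀ n ≥ N, udist (s n) a < ε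

/-- `p : [0,1] → [0,1]` restricts to an order-isomorphism from the subset `S` onto `[0,1]`. -/
def RestrictsToIso (p : U) (S : Set II) : Prop := StrictMonoOn p S ∧ p '' S = Set.univ

/-- `A` is unstackable. -/
def IsUnstackable : Prop :=
  ∀ (r : II), 0 < r → r < 1 → ∀ p q : U,
    RestrictsToIso p (Set.Icc 0 r) → RestrictsToIso q (Set.Icc r 1) →
    ∀ a b : A, p • a ≤ p • b → q • a ≤ q • b → a ≤ b

/-- `A` is stackable. -/
def IsStackable : Prop :=
  IsUnstackable A ∧
  ∀ (r : II), 0 < r → r < 1 → ∀ p q : U,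
    RestrictsToIso p (Set.Icc 0 r) → RestrictsToIso q (Set.Icc r 1) →
    ∀ a b : A, (∀ p' q' : U, q' • b ≤ p' • a) → ∃! c : A, p • c = a ∧ q • c = b

end UPoset

/-! ### `U`-meet-semilattices -/

/-- A `U`-meet-semilattice: a `U`-poset with finite meets (including the empty meet `⊤`) that are
preserved by the action of every element of `U`. -/
class UMeetSemilattice (A : Type u) extends SemilatticeInf A, OrderTop A, UPoset A where
  smul_inf : ∀ (p : U) (a b : A), p • (a ⊓ b) = p • a ⊓ p • b
  smul_top : ∀ p : U, p • (⊤ : A) = ⊤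

/-- Morphisms of `U`-meet-semilattices: `U`-equivariant maps preserving finite meets. -/
structure UMeetHom (A : Type u) (B : Type v) [UMeetSemilattice A] [UMeetSemilattice B]
    extends InfTopHom A B where
  map_smul' : ∀ (p : U) (a : A), toFun (p • a) = p • toFun a

namespace UMeetHom

variable {A : Type u} {B : Type v} {C : Type w}
  [UMeetSemilattice A] [UMeetSemilattice B] [UMeetSemilattice C]

instance : FunLike (UMeetHom A B) A B where
  coe f := f.toFun
  coe_injective f g h := by
    obtain ⟨⟨⟨f, _⟩, _⟩, _⟩ := f
    obtain ⟨⟨⟨g, _⟩, _⟩, _⟩ := g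
    congr

@[ext] theorem ext {f g : UMeetHom A B} (h : ∀ a, f a = g a) : f = g := DFunLike.ext f g h

protected theorem map_inf (f : UMeetHom A B) (a b : A) : f (a ⊓ b) = f a ⊓ f b := f.map_inf' a b
protected theorem map_top (f : UMeetHom A B) : f ⊤ = ⊤ := f.map_top'
protected theorem map_smul (f : UMeetHom A B) (p : U) (a : A) : f (p • a) = p • f a :=
  f.map_smul' p a

/-- The identity morphism. -/
def id (A : Type u) [UMeetSemilattice A] : UMeetHom A A where
  toFun a := a
  map_inf' _ _ := rfl
  map_top' := rfl
  map_smul' _ _ := rfl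

/-- Composition of morphisms. -/
def comp (g : UMeetHom B C) (f : UMeetHom A B) : UMeetHom A C where
  toFun a := g (f a)
  map_inf' a b := by rw [f.map_inf, g.map_inf]
  map_top' := by rw [f.map_top, g.map_top]
  map_smul' p a := by rw [f.map_smul, g.map_smul]

end UMeetHom

/-- `[0,1]` as a `U`-meet-semilattice: `U` acts by evaluation. -/
noncomputable instance : UMeetSemilattice II where
  smul p t := p t
  one_smul _ := rfl
  mul_smul _ _ _ := rfl
  smul_mono_left h t := h t
  smul_mono_right p _ _ h := p.monotone h
  smul_inf p a b := InfHomClass.map_inf p a b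
  smul_top p := TopHomClass.map_top p

/-! ### Continuous lattices -/

/-- The way-below relation: `x ≪ y` if `x` belongs to every ideal (nonempty directed lower set)
whose join is above `y`. -/
def WayBelow {X : Type u} [CompleteLattice X] (x y : X) : Prop :=
  ∀ I : Order.Ideal X, y ≤ sSup (I : Set X) → x ∈ I

/-- A complete lattice `X` is continuous if below every `x` there is an ideal of elements
way below `x` whose join is above `x`. -/
def IsContinuousLattice (X : Type u) [CompleteLattice X] : Prop :=
  ∀ x : X, ∃ I : Order.Ideal X, (∀ y ∈ I, WayBelow y x) ∧ x ≤ sSup (I : Set X)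

/-- Morphisms of continuous lattices: maps preserving arbitrary meets and (nonempty) directed
joins. -/
structure CtsLatHom (X : Type u) (Y : Type v) [CompleteLattice X] [CompleteLattice Y]
    extends sInfHom X Y where
  scottContinuous' : ScottContinuous toFun

namespace CtsLatHom

variable {X : Type u} {Y : Type v} {Z : Type w}
  [CompleteLattice X] [CompleteLattice Y] [CompleteLattice Z]

instance : FunLike (CtsLatHom X Y) X Y where
  coe f := f.toFun
  coe_injective f g h := by
    obtain ⟨⟨f, _⟩, _⟩ := f
    obtain ⟨⟨g, _⟩, _⟩ := g
    congr

@[ext] theorem ext {f g : CtsLatHom X Y} (h : ∀ x, f x = g x) : f = g := DFunLike.ext f g h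

protected theorem map_sInf (f : CtsLatHom X Y) (s : Set X) : f (sInf s) = sInf (f '' s) :=
  f.map_sInf' s
protected theorem scottContinuous (f : CtsLatHom X Y) : ScottContinuous f := f.scottContinuous'
protected theorem monotone (f : CtsLatHom X Y) : Monotone f := f.scottContinuous.monotone

/-- The identity morphism. -/
def id (X : Type u) [CompleteLattice X] : CtsLatHom X X where
  toFun x := x
  map_sInf' s := by simp
  scottContinuous' := ScottContinuous.id

/-- Composition of morphisms. -/
def comp (g : CtsLatHom Y Z) (f : CtsLatHom X Y) : CtsLatHom X Z where
  toFun x := g (f x)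
  map_sInf' s := by rw [f.map_sInf, g.map_sInf, Set.image_image]
  scottContinuous' := ScottContinuous.comp f.scottContinuous g.scottContinuous

end CtsLatHom

/-! ### The two categories -/

/-- Continuous lattices. -/
structure CtsLat : Type (u + 1) where
  carrier : Type u
  [str : CompleteLattice carrier]
  isContinuous : IsContinuousLattice carrier

namespace CtsLat

instance : CoeSort CtsLat.{u} (Type u) := ⟨carrier⟩

instance (X : CtsLat.{u}) : CompleteLattice X := X.str

instance : Category CtsLat.{u} where
  Hom X Y := CtsLatHom X Y
  id X := CtsLatHom.id X
  comp f g := CtsLatHom.comp g f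
  id_comp _ := rfl
  comp_id _ := rfl
  assoc _ _ _ := rfl

end CtsLat

/-- Complete stackable `U`-meet-semilattices. -/
structure CStUMeet : Type (u + 1) where
  carrier : Type u
  [str : UMeetSemilattice carrier]
  isComplete : IsCauchyComplete carrier
  isStackable : IsStackable carrier

namespace CStUMeet

instance : CoeSort CStUMeet.{u} (Type u) := ⟨carrier⟩

instance (A : CStUMeet.{u}) : UMeetSemilattice A := A.str

instance : Category CStUMeet.{u} where
  Hom A B := UMeetHom A B
  id A := UMeetHom.id A
  comp f g := UMeetHom.comp g f
  id_comp _ := rfl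
  comp_id _ := rfl
  assoc _ _ _ := rfl

end CStUMeet

/-! ### The dual of a complete lattice: morphisms to `[0,1]`, with pointwise operations -/

section CtsDual

variable {X : Type u} [CompleteLattice X]

/-- The pointwise order. -/
noncomputable instance : PartialOrder (CtsLatHom X II) :=
  PartialOrder.lift (fun f : CtsLatHom X II => (f : X → II)) DFunLike.coe_injective

theorem scottContinuous_inf {f g : X → II} (hf : ScottContinuous f) (hg : ScottContinuous g) :
    ScottContinuous (fun x => f x ⊓ g x) := by
  intro d hd hdir a ha
  refine ⟨?_, fun b hb => ?_⟩
  · rintro _ ⟨x, hx, rfl⟩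
    exact inf_le_inf (hf.monotone (ha.1 hx)) (hg.monotone (ha.1 hx))
  · by_contra h
    obtain ⟨h1, h2⟩ := lt_inf_iff.1 (not_le.1 h)
    obtain ⟨_, ⟨x, hx, rfl⟩, hbx⟩ := (lt_isLUB_iff (hf hd hdir ha)).1 h1
    obtain ⟨_, ⟨y, hy, rfl⟩, hby⟩ := (lt_isLUB_iff (hg hd hdir ha)).1 h2
    obtain ⟨z, hz, hxz, hyz⟩ := hdir x hx y hy
    exact absurd (hb ⟨z, hz, rfl⟩)
      (not_le.2 (lt_inf_iff.2 ⟨hbx.trans_le (hf.monotone hxz), hby.trans_le (hg.monotone hyz)⟩))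

/-- Pointwise finite meets, and the action `(p • f) x = p (f x)`. -/
noncomputable instance : UMeetSemilattice (CtsLatHom X II) where
  inf f g :=
    { toFun := fun x => f x ⊓ g x
      map_sInf' := fun s => by
        simp only [f.map_sInf, g.map_sInf, sInf_image, iInf_inf_eq]
      scottContinuous' := scottContinuous_inf f.scottContinuous g.scottContinuous }
  inf_le_left _ _ _ := inf_le_left
  inf_le_right _ _ _ := inf_le_right
  le_inf _ _ _ h k x := le_inf (h x) (k x)
  top :=
    { toFun := fun _ => ⊤
      map_sInf' := fun s => by simp [sInf_image]
      scottContinuous' := fun d hd _ a _ => by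
        rw [hd.image_const]
        exact isLUB_singleton }
  le_top _ _ := le_top
  smul p f :=
    { toFun := fun x => p (f x)
      map_sInf' := fun s => by rw [f.map_sInf, map_sInf, Set.image_image]
      scottContinuous' := ScottContinuous.comp f.scottContinuous p.scottContinuous }
  one_smul _ := rfl
  mul_smul _ _ _ := rfl
  smul_mono_left h f x := h (f x)
  smul_mono_right p _ _ h x := p.monotone (h x)
  smul_inf p f g := CtsLatHom.ext fun x => InfHomClass.map_inf p (f x) (g x)
  smul_top p := CtsLatHom.ext fun _ => TopHomClass.map_top p

end CtsDual

/-- Precomposition with a morphism `h : X → Y` is a morphism between the duals. -/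
noncomputable def CtsLatHom.precomp {X : Type u} {Y : Type v} [CompleteLattice X]
    [CompleteLattice Y] (h : CtsLatHom X Y) : UMeetHom (CtsLatHom Y II) (CtsLatHom X II) where
  toFun f := f.comp h
  map_inf' _ _ := rfl
  map_top' := rfl
  map_smul' _ _ := rfl

/-! ### The dual of a `U`-meet-semilattice: morphisms to `[0,1]`, with the pointwise order -/

section UDual

variable {A : Type u} [UMeetSemilattice A]

/-- The pointwise order. -/
noncomputable instance : PartialOrder (UMeetHom A II) :=
  PartialOrder.lift (fun f : UMeetHom A II => (f : A → II)) DFunLike.coe_injective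

/-- Pointwise meets. -/
noncomputable instance : InfSet (UMeetHom A II) where
  sInf S :=
    { toFun := fun a => ⨅ f ∈ S, f a
      map_inf' := fun a b => by simp only [UMeetHom.map_inf, iInf_inf_eq]
      map_top' := by simp only [UMeetHom.map_top, iInf_top]
      map_smul' := fun p a => by
        change (⨅ f ∈ S, f (p • a)) = p (⨅ f ∈ S, f a)
        simp only [map_iInf]
        exact iInf_congr fun f => iInf_congr fun _ => f.map_smul p a }

/-- The complete lattice of morphisms to `[0,1]`: meets are computed pointwise. -/
noncomputable instance : CompleteLattice (UMeetHom A II) :=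
  completeLatticeOfInf (UMeetHom A II) fun _ =>
    ⟨fun _ hf _ => iInf₂_le _ hf, fun _ hg a => le_iInf₂ fun _ hf => hg hf a⟩

theorem UMeetHom.sInf_apply (S : Set (UMeetHom A II)) (a : A) : sInf S a = ⨅ f ∈ S, f a := rfl

/-- Directed joins are computed pointwise as well. -/
theorem UMeetHom.isLUB_apply {d : Set (UMeetHom A II)} (hd : d.Nonempty)
    (hdir : DirectedOn (· ≤ ·) d) {g : UMeetHom A II} (hg : IsLUB d g) (a : A) :
    IsLUB ((fun f : UMeetHom A II => f a) '' d) (g a) := by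
  let k : UMeetHom A II :=
    { toFun := fun a => ⨆ f ∈ d, f a
      map_inf' := fun a b => by
        refine le_antisymm (iSup₂_le fun f hf => ?_) ?_
        · rw [f.map_inf]
          exact inf_le_inf (le_iSup₂ (f := fun (f : UMeetHom A II) (_ : f ∈ d) => f a) f hf)
            (le_iSup₂ (f := fun (f : UMeetHom A II) (_ : f ∈ d) => f b) f hf)
        · refine le_of_forall_lt fun c hc => ?_
          obtain ⟨h1, h2⟩ := lt_inf_iff.1 hc
          simp only [lt_iSup_iff] at h1 h2 ⊢
          obtain ⟨f, hf, h1⟩ := h1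
          obtain ⟨f', hf', h2⟩ := h2
          obtain ⟨e, he, hfe, hfe'⟩ := hdir f hf f' hf'
          refine ⟨e, he, ?_⟩
          rw [e.map_inf]
          exact lt_inf_iff.2 ⟨h1.trans_le (hfe a), h2.trans_le (hfe' b)⟩
      map_top' := by
        simp only [UMeetHom.map_top]
        exact biSup_const hd
      map_smul' := fun p a => by
        change (⨆ f ∈ d, f (p • a)) = p (⨆ f ∈ d, f a)
        simp only [map_iSup]
        exact iSup_congr fun f => iSup_congr fun _ => f.map_smul p a }
  have hk : IsLUB d k :=
    ⟨fun f hf a => le_iSup₂ (f := fun (f : UMeetHom A II) (_ : f ∈ d) => f a) f hf,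
      fun h hh a => iSup₂_le fun f hf => hh hf a⟩
  rw [hg.unique hk]
  change IsLUB _ (⨆ f ∈ d, f a)
  exact isLUB_biSup

end UDual

/-- Precomposition with a morphism `h : A → B` is a morphism between the duals. -/
noncomputable def UMeetHom.precomp {A : Type u} {B : Type v} [UMeetSemilattice A]
    [UMeetSemilattice B] (h : UMeetHom A B) : CtsLatHom (UMeetHom B II) (UMeetHom A II) where
  toFun f := f.comp h
  map_sInf' S := UMeetHom.ext fun a => by
    rw [UMeetHom.sInf_apply, iInf_image]
    rfl
  scottContinuous' := fun d hd hdir g hg =>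
    ⟨by
      rintro _ ⟨f, hf, rfl⟩ a
      exact hg.1 hf (h a),
    fun k hk a => (UMeetHom.isLUB_apply hd hdir hg (h a)).2 (by
      rintro _ ⟨f, hf, rfl⟩
      exact hk ⟨f, hf, rfl⟩ a)⟩

/-! ### The evaluation maps -/

/-- The evaluation map `x ↦ (f ↦ f x)` of a complete lattice into its double dual. -/
noncomputable def CtsLatHom.eval (X : Type u) [CompleteLattice X] :
    CtsLatHom X (UMeetHom (CtsLatHom X II) II) where
  toFun x :=
    { toFun := fun f => f x
      map_inf' := fun _ _ => rfl
      map_top' := rfl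
      map_smul' := fun _ _ => rfl }
  map_sInf' s := UMeetHom.ext fun f => by
    rw [UMeetHom.sInf_apply, iInf_image, ← sInf_image]
    exact f.map_sInf s
  scottContinuous' := fun d hd hdir x hx =>
    ⟨by
      rintro _ ⟨y, hy, rfl⟩ f
      exact f.monotone (hx.1 hy),
    fun k hk f => (f.scottContinuous hd hdir hx).2 (by
      rintro _ ⟨y, hy, rfl⟩
      exact hk ⟨y, hy, rfl⟩ f)⟩

/-- The evaluation map `a ↦ (f ↦ f a)` of a `U`-meet-semilattice into its double dual. -/
noncomputable def UMeetHom.eval (A : Type u) [UMeetSemilattice A] :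
    UMeetHom A (CtsLatHom (UMeetHom A II) II) where
  toFun a :=
    { toFun := fun f => f a
      map_sInf' := fun S => by
        rw [UMeetHom.sInf_apply, sInf_image]
      scottContinuous' := fun _ hd hdir _ hg => UMeetHom.isLUB_apply hd hdir hg a }
  map_inf' a b := CtsLatHom.ext fun f => f.map_inf a b
  map_top' := CtsLatHom.ext fun f => f.map_top
  map_smul' p a := CtsLatHom.ext fun f => f.map_smul p a

/-! ### The two hom functors -/

/-- The contravariant functor `X ↦ Hom(X, [0,1])` from continuous lattices to complete stackable
`U`-meet-semilattices, given that these duals are complete and stackable. -/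
noncomputable def ctsDual
    (h : ∀ X : CtsLat.{u}, IsCauchyComplete (CtsLatHom X II) ∧ IsStackable (CtsLatHom X II)) :
    CtsLat.{u}ᵒᵖ ⥤ CStUMeet.{u} where
  obj X := ⟨CtsLatHom X.unop II, (h X.unop).1, (h X.unop).2⟩
  map f := CtsLatHom.precomp f.unop
  map_id _ := rfl
  map_comp _ _ := rfl

/-- The contravariant functor `A ↦ Hom(A, [0,1])` from complete stackable `U`-meet-semilattices to
continuous lattices, given that these duals are continuous. -/
noncomputable def uDual (h : ∀ A : CStUMeet.{u}, IsContinuousLattice (UMeetHom A II)) :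
    CStUMeet.{u}ᵒᵖ ⥤ CtsLat.{u} where
  obj A := ⟨UMeetHom A.unop II, h A.unop⟩
  map f := UMeetHom.precomp f.unop
  map_id _ := rfl
  map_comp _ _ := rfl

end CtsDuality

namespace CtsDuality

/-! ### The monoid `U` -/

namespace U

/-! Both evaluation maps are isomorphisms, and the triangle identities hold definitionally, so the
duality reduces to separation of points and surjectivity on each side. A recurring device is that a
morphism to `[0,1]` on a `U`-meet-semilattice is determined by where it equals 1, since `φ a ≥ r`
says that `φ` is 1 at `ramp 0 r • a` (for `r > 0`).

For a continuous lattice, separation is Urysohn's lemma: interpolation in `≪` produces a dyadic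
scale and hence a morphism to `[0,1]`. Surjectivity uses no continuity: a morphism `φ` on the dual
is evaluation at the join of the least points where `h` reaches 1, over all `h` with `φ h = 1`.

For a `U`-meet-semilattice, each element generates a morphism whose values are those forced by
inequalities `p • c ≤ q • b`. This gives `p • a ≤ q • b` when one threshold separates `p` from `q`
(`smul_le_smul_of_forall_hom_le`). Unstackability chains finitely many thresholds, and the
Archimedean property passes to the limit, so morphisms detect the order (`le_of_forall_hom_le`). For
surjectivity, a morphism on the dual is bisected repeatedly at `1/2`; stackability reassembles
approximations of the two halves with half the error (`exists_uniform_approx`), and Cauchy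
completeness supplies the limit. -/

@[simp] theorem map_zero (p : U) : p 0 = 0 := map_bot p

@[simp] theorem map_one (p : U) : p 1 = 1 := map_top p

/-- The candidate preimage of `y` is the last point where `p ≤ y`: preserving joins gives `≤` there,
and preserving the meet of all later points gives `≥`. -/
theorem surjective (p : U) : Function.Surjective p := by
  intro y
  refine ⟨sSup {t | p t ≤ y}, le_antisymm ?_ ?_⟩
  · rw [map_sSup]
    exact sSup_le (by rintro _ ⟨t, ht, rfl⟩; exact ht)
  · set x := sSup {t | p t ≤ y} with hx
    have key : ∀ t, x < t → y ≤ p t := fun t ht =>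
      (not_le.1 fun h => not_le.2 ht (le_sSup (s := {t | p t ≤ y}) h)).le
    rcases eq_or_lt_of_le (le_top : x ≤ ⊤) with h | h
    · rw [h, map_top]; exact le_top
    · have : sInf (Set.Ioi x) = x := by
        refine (IsGLB.sInf_eq ?_)
        have : (nhdsWithin x (Set.Ioi x)).NeBot := nhdsGT_neBot_of_exists_gt ⟨_, h⟩
        exact isGLB_Ioi
      rw [← this, map_sInf]
      exact le_sInf (by rintro _ ⟨t, ht, rfl⟩; exact key t ht)

theorem continuous (p : U) : Continuous p := p.monotone.continuous_of_surjective p.surjective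

/-- A continuous monotone self-map of `[0,1]` fixing the endpoints, as an element of `U`. -/
def ofContinuous (f : II → II) (hm : Monotone f) (hc : Continuous f) (h0 : f 0 = 0)
    (h1 : f 1 = 1) : U :=
  { toFun := f
    map_sInf' := fun _ => hm.map_sInf_of_continuousAt hc.continuousAt h1
    map_sSup' := fun _ => hm.map_sSup_of_continuousAt hc.continuousAt h0 : CompleteLatticeHom II II }

/-- The map that vanishes on `[0,a]`, is `1` on `[b,1]`, and is affine in between. -/
noncomputable def ramp (a b : II) (h : a < b) : U :=
  ofContinuous (fun t => Set.projIcc 0 1 zero_le_one (((t : ℝ) - a) / (b - a)))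
    (fun s t hst => Set.monotone_projIcc _ (by
      have : (0 : ℝ) < b - a := sub_pos.2 h
      have : (s : ℝ) ≤ t := hst
      gcongr))
    (continuous_projIcc.comp (by fun_prop))
    (Set.projIcc_of_le_left _ (div_nonpos_of_nonpos_of_nonneg
      (by simpa using a.2.1) (sub_nonneg.2 (le_of_lt h))))
    (Set.projIcc_of_right_le _ ((one_le_div (sub_pos.2 (show (a : ℝ) < b from h))).2 (by
      have := b.2.2
      simpa using this)))

theorem coe_ramp {a b : II} (h : a < b) (t : II) :
    (ramp a b h t : ℝ) = max 0 (min 1 (((t : ℝ) - a) / (b - a))) := rfl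

@[simp] theorem ramp_eq_zero {a b : II} (h : a < b) {t : II} : ramp a b h t = 0 ↔ t ≤ a := by
  have hab : (0 : ℝ) < b - a := sub_pos.2 h
  refine (Set.projIcc_eq_left (zero_lt_one' ℝ)).trans ?_
  rw [div_le_iff₀ hab, zero_mul, sub_nonpos]
  rfl

@[simp] theorem ramp_eq_one {a b : II} (h : a < b) {t : II} : ramp a b h t = 1 ↔ b ≤ t := by
  have hab : (0 : ℝ) < b - a := sub_pos.2 h
  refine (Set.projIcc_eq_right (zero_lt_one' ℝ)).trans ?_
  rw [one_le_div hab, sub_le_sub_iff_right]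
  rfl

theorem coe_ramp_of_mem {a b : II} (h : a < b) {t : II} (ht : t ∈ Set.Icc a b) :
    (ramp a b h t : ℝ) = (t - a) / (b - a) := by
  have hab : (0 : ℝ) < b - a := sub_pos.2 h
  have h1 : (a : ℝ) ≤ t := ht.1
  have h2 : (t : ℝ) ≤ b := ht.2
  rw [coe_ramp, min_eq_right ((div_le_one hab).2 (by linarith)),
    max_eq_right (div_nonneg (by linarith) hab.le)]

theorem ramp_strictMonoOn {a b : II} (h : a < b) : StrictMonoOn (ramp a b h) (Set.Icc a b) := by
  intro s hs t ht hst
  have hab : (0 : ℝ) < b - a := sub_pos.2 h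
  have hst' : (s : ℝ) < t := hst
  rw [← Subtype.coe_lt_coe, coe_ramp_of_mem h hs, coe_ramp_of_mem h ht]
  gcongr

/-- The basic comparison in `U`: left of `r` the map `p` is still 0, and right of `r` the map `q` is
already 1. -/
theorem le_of_zero_one {p q : U} (r : II) (hp : p r = 0) (hq : q r = 1) : p ≤ q := by
  intro t
  rcases le_total t r with h | h
  · have := p.monotone h
    rw [hp] at this
    exact this.trans (q t).2.1
  · have := q.monotone h
    rw [hq] at this
    exact le_trans (p t).2.2 this

/-- The pointwise meet. -/
noncomputable def inf (p q : U) : U :=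
  ofContinuous (fun t => p t ⊓ q t) (fun _ _ h => inf_le_inf (p.monotone h) (q.monotone h))
    (p.continuous.inf q.continuous) (by simp) (by simp)

theorem inf_le_left (p q : U) : inf p q ≤ p := fun _ => _root_.inf_le_left

theorem inf_le_right (p q : U) : inf p q ≤ q := fun _ => _root_.inf_le_right

end U

theorem smul_eq (p : U) (t : II) : p • t = p t := rfl

theorem coe_tadd (r s : II) : (tadd r s : ℝ) = min ((r : ℝ) + s) 1 := rfl

/-- If `d + r < c`, a ramp starting at `d` and its translate by `r` form a test pair that refutes
`LeR r c d`. The converse is monotonicity. -/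
theorem leR_unitInterval {r c d : II} : LeR r c d ↔ (c : ℝ) ≤ d + r := by
  constructor
  · intro h
    by_contra! hlt
    have hc1 := c.2.2
    have hd0 := d.2.1
    have hr0 := r.2.1
    -- The ramps on `[d + r, 1]` and `[d, 1 - r]` have the same slope and differ by translation by
    -- `r`.
    let e : II := ⟨d + r, by positivity, by linarith⟩
    let f : II := ⟨1 - r, by linarith [r.2.2], by linarith⟩
    have he : e < 1 := Subtype.coe_lt_coe.1 (by simp only [e, Set.Icc.coe_one]; linarith)
    have hf : d < f := Subtype.coe_lt_coe.1 (by simp only [f]; linarith)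
    have hq : U.ramp d f hf d = 0 := (U.ramp_eq_zero hf).2 le_rfl
    have hp : U.ramp e 1 he c = 0 := le_antisymm (by
      rw [← hq]
      refine h (U.ramp e 1 he) (U.ramp d f hf) fun t => ?_
      rcases le_or_gt f t with ht | ht
      · rw [(U.ramp_eq_one hf).2 ht]
        exact le_top
      · have ht' : (t : ℝ) < 1 - r := ht
        rw [← Subtype.coe_le_coe, U.coe_ramp, U.coe_ramp, coe_tadd,
          min_eq_left (show (t : ℝ) + r ≤ 1 by linarith)]
        refine le_of_eq ?_
        simp only [e, f, Set.Icc.coe_one]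
        congr 3
        · ring
        · ring) (U.ramp e 1 he c).2.1
    rw [U.ramp_eq_zero] at hp
    have : (c : ℝ) ≤ d + r := hp
    linarith
  · intro h p q hpq
    refine le_trans (p.monotone ?_) (hpq d)
    exact Subtype.coe_le_coe.1 (by rw [coe_tadd]; exact le_min h c.2.2)

/-! ### The dual of a `U`-meet-semilattice is continuous -/

section UDual

variable {A : Type u} [UMeetSemilattice A]

namespace UMeetHom

protected theorem monotone {B : Type v} [UMeetSemilattice B] (φ : UMeetHom A B) :
    Monotone φ := fun a b h => by
  rw [← inf_eq_left, ← φ.map_inf, inf_eq_left.2 h]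

/-- The least morphism to `[0,1]` with value `1` at `a`. -/
noncomputable def leastAt (a : A) : UMeetHom A II := sInf {ψ | ψ a = 1}

theorem leastAt_apply (a : A) : leastAt a a = 1 := by
  rw [leastAt, sInf_apply]
  exact le_antisymm le_top (le_iInf₂ fun ψ (hψ : ψ a = 1) => hψ.ge)

theorem leastAt_le {a : A} {φ : UMeetHom A II} (h : φ a = 1) : leastAt a ≤ φ := sInf_le h

theorem lt_sSup_ideal {I : Order.Ideal (UMeetHom A II)} {a : A} {s : II}
    (h : s < sSup (I : Set (UMeetHom A II)) a) : ∃ ψ ∈ I, s < ψ a := by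
  obtain ⟨_, ⟨ψ, hψ, rfl⟩, hs⟩ :=
    (lt_isLUB_iff (isLUB_apply I.nonempty I.directed (isLUB_sSup _) a)).1 h
  exact ⟨ψ, hψ, hs⟩

/-- Directed joins are pointwise, so an ideal with join above `φ` contains some `ψ` with `ψ a > r`;
rescaling by `ramp 0 r` turns this into value 1, where minimality of `leastAt` applies. -/
theorem wayBelow_leastAt {φ : UMeetHom A II} {a : A} (ha : φ a = 1) {r : II} (h0 : 0 < r)
    (h1 : r < 1) : WayBelow (leastAt (U.ramp 0 r h0 • a)) φ := by
  intro I hI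
  obtain ⟨ψ, hψ, hr⟩ := lt_sSup_ideal (s := r) (h1.trans_le (ha.ge.trans (hI a)))
  refine I.lower (leastAt_le ?_) hψ
  rw [ψ.map_smul, smul_eq, U.ramp_eq_one]
  exact hr.le

/-- The ideal generated by the morphisms `leastAt (ramp 0 r • a)` with `φ a = 1` and `r < 1`. -/
noncomputable def approxIdeal (φ : UMeetHom A II) : Order.Ideal (UMeetHom A II) where
  carrier := {ψ | ∃ (a : A) (r : II) (h0 : 0 < r), φ a = 1 ∧ r < 1 ∧
    ψ ≤ leastAt (U.ramp 0 r h0 • a)}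
  lower' := fun _ _ h ⟨a, r, h0, ha, h1, hle⟩ => ⟨a, r, h0, ha, h1, h.trans hle⟩
  nonempty' := by
    obtain ⟨r, h0, h1⟩ := exists_between (zero_lt_one' II)
    exact ⟨_, ⊤, r, h0, φ.map_top, h1, le_rfl⟩
  directed' := by
    rintro ψ ⟨a, r, h0, ha, h1, hψ⟩ ψ' ⟨a', r', h0', ha', h1', hψ'⟩
    refine ⟨_, ⟨a ⊓ a', r ⊔ r', lt_sup_of_lt_left h0, ?_, sup_lt_iff.2 ⟨h1, h1'⟩, le_rfl⟩,
      hψ.trans (leastAt_le ?_), hψ'.trans (leastAt_le ?_)⟩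
    · rw [φ.map_inf, ha, ha', inf_idem]
    all_goals
      set θ := leastAt (U.ramp 0 (r ⊔ r') (lt_sup_of_lt_left h0) • (a ⊓ a')) with hθ
      have h : θ (U.ramp 0 (r ⊔ r') (lt_sup_of_lt_left h0) • (a ⊓ a')) = 1 := leastAt_apply _
      rw [θ.map_smul, smul_eq, U.ramp_eq_one, θ.map_inf] at h
      rw [θ.map_smul, smul_eq, U.ramp_eq_one]
    · exact le_sup_left.trans (h.trans inf_le_left)
    · exact le_sup_right.trans (h.trans inf_le_right)

theorem le_sSup_approxIdeal (φ : UMeetHom A II) :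
    φ ≤ sSup (approxIdeal φ : Set (UMeetHom A II)) := by
  intro b
  refine le_of_forall_lt fun s hs => ?_
  have h0 : 0 < φ b := lt_of_le_of_lt s.2.1 hs
  have hs' : U.ramp 0 (φ b) h0 s < 1 :=
    lt_of_le_of_ne le_top fun h => not_le.2 hs ((U.ramp_eq_one h0).1 h)
  obtain ⟨r, hsr, hr1⟩ := exists_between hs'
  have hr0 : 0 < r := lt_of_le_of_lt (U.ramp 0 (φ b) h0 s).2.1 hsr
  -- Rescaling `b` makes `φ` equal to 1 there; `r` lies above the rescaled `s`, so a value of at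
  -- least `r` at the rescaled element forces a value above `s` at `b`.
  set ψ := leastAt (U.ramp 0 r hr0 • (U.ramp 0 (φ b) h0 • b)) with hψ
  have hmem : ψ ∈ approxIdeal φ :=
    ⟨_, r, hr0, by rw [φ.map_smul, smul_eq, U.ramp_eq_one], hr1, le_rfl⟩
  refine lt_of_lt_of_le ?_ (le_sSup (a := ψ) hmem b)
  have h : ψ (U.ramp 0 r hr0 • (U.ramp 0 (φ b) h0 • b)) = 1 := leastAt_apply _
  rw [ψ.map_smul, smul_eq, U.ramp_eq_one, ψ.map_smul, smul_eq] at h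
  by_contra! hle
  exact not_lt.2 (h.trans ((U.ramp 0 (φ b) h0).monotone hle)) hsr

end UMeetHom

variable (A) in
theorem isContinuousLattice_uDual : IsContinuousLattice (UMeetHom A II) := fun φ =>
  ⟨UMeetHom.approxIdeal φ, fun _ ⟨_, _, h0, ha, h1, hle⟩ I hI =>
    I.lower hle (UMeetHom.wayBelow_leastAt ha h0 h1 I hI), UMeetHom.le_sSup_approxIdeal φ⟩

/-! ### Morphisms to `[0,1]` generated by an element -/

/-- Collapsing `[0, q r]` to 0 makes the function acting on `b` vanish at `r`, where `ramp 0 r` is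
already 1. Every witness is thereby put in a normal form depending only on `r`. -/
theorem exists_smul_le_ramp_smul {c b : A} {p q : U} {r : II} (hr : 0 < r) (hq : q r < 1)
    (h : p • c ≤ q • b) : ∃ p' : U, p' • c ≤ U.ramp 0 r hr • b := by
  refine ⟨U.ramp (q r) 1 hq * p, ?_⟩
  rw [mul_smul]
  refine (UPoset.smul_mono_right _ h).trans ?_
  rw [← mul_smul]
  refine UPoset.smul_mono_left (U.le_of_zero_one r ?_ ?_) b
  · rw [U.mul_apply, U.ramp_eq_zero]
  · rw [U.ramp_eq_one]

/-- The values `r` that a morphism which is `1` at `c` is forced to exceed or attain at `b`. -/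
def forcedValues (c b : A) : Set II := {r | ∃ p q : U, q r < 1 ∧ p • c ≤ q • b}

theorem lt_sSup_forcedValues {c b : A} {r : II} (hr : 0 < r) (h : r < sSup (forcedValues c b)) :
    ∃ p : U, p • c ≤ U.ramp 0 r hr • b := by
  obtain ⟨s, ⟨p, q, hq, hpq⟩, hrs⟩ := lt_sSup_iff.1 h
  exact exists_smul_le_ramp_smul hr ((q.monotone hrs.le).trans_lt hq) hpq

theorem le_sSup_forcedValues {c b : A} {r : II} (hr : 0 < r) {p : U}
    (h : p • c ≤ U.ramp 0 r hr • b) : r ≤ sSup (forcedValues c b) := by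
  refine le_of_forall_lt fun s hs => ?_
  obtain ⟨t, hst, htr⟩ := exists_between hs
  refine hst.trans_le (le_sSup ⟨p, _, lt_of_le_of_ne le_top fun h1 => ?_, h⟩)
  exact not_le.2 htr ((U.ramp_eq_one hr).1 h1)

theorem forcedValues_mono (c : A) {b b' : A} (h : b ≤ b') :
    forcedValues c b ⊆ forcedValues c b' := fun _ ⟨p, q, hq, hpq⟩ =>
  ⟨p, q, hq, hpq.trans (UPoset.smul_mono_right q h)⟩

/-- The morphism to `[0,1]` generated by `c`. -/
noncomputable def generatedHom (c : A) : UMeetHom A II where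
  toFun b := sSup (forcedValues c b)
  map_inf' a b := by
    refine le_antisymm (le_inf (sSup_le_sSup (forcedValues_mono c inf_le_left))
      (sSup_le_sSup (forcedValues_mono c inf_le_right))) (le_of_forall_lt fun r hr => ?_)
    obtain ⟨s, hrs, hs⟩ := exists_between hr
    have hs0 : 0 < s := lt_of_le_of_lt r.2.1 hrs
    obtain ⟨ha, hb⟩ := lt_inf_iff.1 hs
    obtain ⟨p, hp⟩ := lt_sSup_forcedValues hs0 ha
    obtain ⟨q, hq⟩ := lt_sSup_forcedValues hs0 hb
    refine hrs.trans_le (le_sSup_forcedValues hs0 (p := U.inf p q) ?_)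
    rw [UMeetSemilattice.smul_inf]
    exact le_inf ((UPoset.smul_mono_left (U.inf_le_left p q) c).trans hp)
      ((UPoset.smul_mono_left (U.inf_le_right p q) c).trans hq)
  map_top' := by
    refine le_antisymm le_top (le_sSup_forcedValues (r := 1) zero_lt_one (p := 1) ?_)
    rw [UMeetSemilattice.smul_top]
    exact le_top
  map_smul' w b := by
    rw [smul_eq, map_sSup]
    refine le_antisymm (sSup_le ?_) (sSup_le ?_)
    · rintro r ⟨p, q, hq, hpq⟩
      obtain ⟨t, rfl⟩ := w.surjective r
      exact le_sSup ⟨t, ⟨p, q * w, hq, by rwa [mul_smul]⟩, rfl⟩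
    · rintro _ ⟨r, ⟨p, q, hq, hpq⟩, rfl⟩
      rcases eq_or_lt_of_le (show 0 ≤ w r from (w r).2.1) with h0 | h0
      · rw [← h0]
        exact bot_le
      · refine le_sSup_forcedValues h0 (p := U.ramp (q r) 1 hq * p) ?_
        rw [mul_smul]
        refine (UPoset.smul_mono_right _ hpq).trans ?_
        rw [← mul_smul, ← mul_smul]
        refine UPoset.smul_mono_left (U.le_of_zero_one r ?_ ?_) b
        · rw [U.mul_apply, U.ramp_eq_zero]
        · rw [U.mul_apply, U.ramp_eq_one]

/-! ### Morphisms to `[0,1]` detect the order -/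

theorem smul_le_smul_of_forall_hom_le {a b : A} (h : ∀ φ : UMeetHom A II, φ a ≤ φ b) {s r : II}
    (hsr : s < r) {p q : U} (hp : p r = 0) (hq : q s = 1) : p • a ≤ q • b := by
  have hs0 : 0 < s := by
    refine lt_of_le_of_ne s.2.1 fun h0 => ?_
    rw [← h0, q.map_zero] at hq
    exact zero_ne_one hq
  have hr0 := hs0.trans hsr
  -- The morphism generated by `ramp 0 r • a` is at least `r` at `a`, hence at `b`; unwinding its
  -- definition at some `t` between `s` and `r` gives a genuine inequality in `A`.
  have hra : r ≤ generatedHom (U.ramp 0 r hr0 • a) a :=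
    le_sSup_forcedValues hr0 (p := 1) (by rw [one_smul])
  obtain ⟨t, hst, htr⟩ := exists_between hsr
  have ht0 := hs0.trans hst
  obtain ⟨w, hw⟩ := lt_sSup_forcedValues ht0 (htr.trans_le (hra.trans (h _)))
  have hx : U.ramp 0 t ht0 s < 1 :=
    lt_of_le_of_ne le_top fun h1 => not_le.2 hst ((U.ramp_eq_one ht0).1 h1)
  refine le_trans ?_ ((UPoset.smul_mono_right (U.ramp _ 1 hx) hw).trans ?_)
  · rw [← mul_smul, ← mul_smul]
    refine UPoset.smul_mono_left (U.le_of_zero_one r hp ?_) a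
    rw [U.mul_apply, U.mul_apply, (U.ramp_eq_one hr0).2 le_rfl, U.map_one, U.map_one]
  · rw [← mul_smul]
    refine UPoset.smul_mono_left (U.le_of_zero_one s ?_ hq) b
    rw [U.mul_apply, U.ramp_eq_zero]

theorem restrictsToIso_ramp_left {r : II} (h : 0 < r) :
    RestrictsToIso (U.ramp 0 r h) (Set.Icc 0 r) := by
  refine ⟨U.ramp_strictMonoOn h, Set.eq_univ_of_forall fun y => ?_⟩
  obtain ⟨x, rfl⟩ := (U.ramp 0 r h).surjective y
  refine ⟨x ⊓ r, ⟨le_inf x.2.1 h.le, inf_le_right⟩, ?_⟩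
  rw [InfHomClass.map_inf, (U.ramp_eq_one h).2 le_rfl]
  exact inf_eq_left.2 le_top

theorem restrictsToIso_ramp_right {r : II} (h : r < 1) :
    RestrictsToIso (U.ramp r 1 h) (Set.Icc r 1) := by
  refine ⟨U.ramp_strictMonoOn h, Set.eq_univ_of_forall fun y => ?_⟩
  obtain ⟨x, rfl⟩ := (U.ramp r 1 h).surjective y
  refine ⟨x ⊔ r, ⟨le_sup_right, sup_le x.2.2 h.le⟩, ?_⟩
  rw [SupHomClass.map_sup, (U.ramp_eq_zero h).2 le_rfl]
  exact sup_eq_left.2 bot_le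

/-- The `y i` cut the target interval into pieces on each of which one threshold `s < r` separates
the rescaled `p` and `q`. Unstackability at `y n` splits off the last piece, and induction handles
the lower part after rescaling. -/
theorem smul_le_smul_of_thresholds (hA : IsUnstackable A) {a b : A}
    (h : ∀ φ : UMeetHom A II, φ a ≤ φ b) (n : ℕ) (p q : U) (y : ℕ → II) (h0 : y 0 = 0)
    (hn : y n = 1) (hy : ∀ i < n, ∃ s r, s < r ∧ p r ≤ y i ∧ y (i + 1) ≤ q s) :
    p • a ≤ q • b := by
  induction n generalizing p q y with
  | zero => exact absurd (h0.symm.trans hn) zero_ne_one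
  | succ n ih =>
    obtain ⟨s, r, hsr, hp, hq⟩ := hy n n.lt_succ_self
    rw [hn] at hq
    have hq1 : q s = 1 := le_antisymm le_top hq
    rcases eq_or_lt_of_le (show 0 ≤ y n from (y n).2.1) with hy0 | hy0
    · exact smul_le_smul_of_forall_hom_le h hsr (le_antisymm (hp.trans hy0.ge) (p r).2.1) hq1
    rcases eq_or_lt_of_le (show y n ≤ 1 from (y n).2.2) with hy1 | hy1
    · exact ih p q y h0 hy1 fun i hi => hy i (hi.trans n.lt_succ_self)
    refine hA (y n) hy0 hy1 _ _ (restrictsToIso_ramp_left hy0) (restrictsToIso_ramp_right hy1)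
      _ _ ?_ ?_
    · rw [← mul_smul, ← mul_smul]
      refine ih _ _ (fun i => U.ramp 0 (y n) hy0 (y i)) (by simp [h0])
        ((U.ramp_eq_one hy0).2 le_rfl) fun i hi => ?_
      obtain ⟨s, r, hsr, hp, hq⟩ := hy i (hi.trans n.lt_succ_self)
      exact ⟨s, r, hsr, (U.ramp 0 (y n) hy0).monotone hp, (U.ramp 0 (y n) hy0).monotone hq⟩
    · rw [← mul_smul, ← mul_smul]
      refine smul_le_smul_of_forall_hom_le h hsr ?_ ?_
      · rw [U.mul_apply, U.ramp_eq_zero]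
        exact hp
      · rw [U.mul_apply, hq1, U.map_one]

/-- In an Archimedean unstackable `U`-meet-semilattice, the morphisms to `[0,1]` detect the
order. -/
theorem le_of_forall_hom_le (hA : IsArchimedean A) (hA' : IsUnstackable A) {a b : A}
    (h : ∀ φ : UMeetHom A II, φ a ≤ φ b) : a ≤ b := by
  refine hA a b fun ε hε p q hpq => ?_
  have hε0 : (0 : ℝ) < ε := hε
  have hε1 := ε.2.2
  rcases eq_or_lt_of_le hε1 with h1 | h1
  · have h2 : tadd 0 ε = 1 := Subtype.ext (by simp [coe_tadd, h1])
    have h3 := hpq 0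
    rw [h2, U.map_one, U.map_zero] at h3
    exact absurd h3 (not_le.2 zero_lt_one)
  obtain ⟨N, hN⟩ := exists_nat_gt (2 / (ε : ℝ))
  have hN' : 2 < N * (ε : ℝ) := (div_lt_iff₀ hε0).1 hN
  -- Steps of `ε / 2` keep `t (i + 1)` strictly below `t i + ε`. The cap `1 - ε` keeps it below 1
  -- and is reached by `i = N`, where `p 1 ≤ q (1 - ε)` forces `q` to be 1.
  let t : ℕ → II := fun i => ⟨min ((i : ℝ) * ((ε : ℝ) / 2)) (1 - ε), le_min (by positivity) (by linarith),
    (min_le_right _ _).trans (by linarith)⟩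
  have ht : ∀ i, (t i : ℝ) = min ((i : ℝ) * ((ε : ℝ) / 2)) (1 - ε) := fun _ => rfl
  refine smul_le_smul_of_thresholds hA' h N p q (fun i => q (t i)) ?_ ?_ fun i _ => ?_
  · have : t 0 = 0 := Subtype.ext (by rw [ht]; simp [hε1])
    simp only [this, U.map_zero]
  · have h2 : tadd (t N) ε = 1 := Subtype.ext (by
      rw [coe_tadd, ht, min_eq_right (show (1 : ℝ) - ε ≤ N * (ε / 2) by linarith)]
      simp)
    have h3 := hpq (t N)
    rw [h2, U.map_one] at h3
    exact le_antisymm le_top h3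
  · refine ⟨t (i + 1), tadd (t i) ε, ?_, hpq _, le_rfl⟩
    rw [← Subtype.coe_lt_coe, coe_tadd, ht, ht]
    push_cast
    refine lt_min ?_ ((min_le_right _ _).trans_lt (by linarith))
    rcases le_total (i * ((ε : ℝ) / 2)) (1 - ε) with hi | hi
    · rw [min_eq_left hi]
      exact (min_le_left _ _).trans_lt (by linarith)
    · rw [min_eq_right hi]
      exact (min_le_right _ _).trans_lt (by linarith)

end UDual

/-! ### The dual of a complete lattice is complete and stackable -/

/-! ### Cutting `[0,1]` at a point -/

section Splitting

variable {p q : U} {r : II}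

theorem RestrictsToIso.apply_right (hp : RestrictsToIso p (Set.Icc 0 r)) :
    p r = 1 := by
  obtain ⟨t, ht, h⟩ := hp.2.ge (Set.mem_univ (1 : II))
  exact le_antisymm le_top (h.ge.trans (p.monotone ht.2))

theorem RestrictsToIso.apply_left (hq : RestrictsToIso q (Set.Icc r 1)) :
    q r = 0 := by
  obtain ⟨t, ht, h⟩ := hq.2.ge (Set.mem_univ (0 : II))
  exact le_antisymm ((q.monotone ht.1).trans h.le) (q r).2.1

theorem le_of_split (hp : RestrictsToIso p (Set.Icc 0 r)) (hq : RestrictsToIso q (Set.Icc r 1))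
    {s t : II} (h1 : p s ≤ p t) (h2 : q s ≤ q t) : s ≤ t := by
  by_contra! hts
  rcases le_total s r with hs | hs
  · exact not_lt.2 h1 (hp.1 ⟨t.2.1, hts.le.trans hs⟩ ⟨s.2.1, hs⟩ hts)
  rcases le_or_gt r t with ht | ht
  · exact not_lt.2 h2 (hq.1 ⟨ht, t.2.2⟩ ⟨hs, s.2.2⟩ hts)
  · exact not_lt.2 h1 ((hp.1 ⟨t.2.1, ht.le⟩ ⟨r.2.1, le_rfl⟩ ht).trans_le (p.monotone hs))

theorem eq_of_split (hp : RestrictsToIso p (Set.Icc 0 r)) (hq : RestrictsToIso q (Set.Icc r 1))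
    {s t : II} (h1 : p s = p t) (h2 : q s = q t) : s = t :=
  le_antisymm (le_of_split hp hq h1.le h2.le) (le_of_split hp hq h1.ge h2.ge)

/-- A pair of coordinates glues when the upper one leaves 0 only after the lower one has reached 1.
-/
theorem exists_split (hp : RestrictsToIso p (Set.Icc 0 r)) (hq : RestrictsToIso q (Set.Icc r 1))
    {c d : II} (h : 0 < d → c = 1) : ∃ t, p t = c ∧ q t = d := by
  rcases eq_or_lt_of_le (show 0 ≤ d from d.2.1) with h0 | h0
  · obtain ⟨t, ht, rfl⟩ := hp.2.ge (Set.mem_univ c)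
    refine ⟨t, rfl, ?_⟩
    rw [← h0]
    exact le_antisymm ((q.monotone ht.2).trans hq.apply_left.le) (q t).2.1
  · obtain ⟨t, ht, rfl⟩ := hq.2.ge (Set.mem_univ d)
    refine ⟨t, ?_, rfl⟩
    rw [h h0]
    exact le_antisymm le_top (hp.apply_right.ge.trans (p.monotone ht.1))

end Splitting

section CtsDual

variable {X : Type u} [CompleteLattice X]

namespace CtsLatHom

theorem smul_apply (p : U) (f : CtsLatHom X II) (x : X) : (p • f) x = p (f x) := rfl

theorem leR_iff {r : II} {f g : CtsLatHom X II} : LeR r f g ↔ ∀ x, (f x : ℝ) ≤ g x + r := by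
  simp only [← leR_unitInterval]
  exact ⟨fun h x p q hpq => h p q hpq x, fun h p q hpq x => h x p q hpq⟩

theorem le_add_of_rho_lt {r : II} {f g : CtsLatHom X II} (h : rho f g < r) (x : X) :
    (f x : ℝ) ≤ g x + r := by
  obtain ⟨s, hs, hsr⟩ := sInf_lt_iff.1 h
  have h1 : (s : ℝ) < r := hsr
  have h2 := leR_iff.1 hs x
  linarith

theorem abs_sub_le_of_udist_lt {r : II} {f g : CtsLatHom X II} (h : udist f g < r) (x : X) :
    |(f x : ℝ) - g x| ≤ r := by
  obtain ⟨h1, h2⟩ := sup_lt_iff.1 h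
  have h1 := le_add_of_rho_lt h1 x
  have h2 := le_add_of_rho_lt h2 x
  rw [abs_le]
  constructor <;> linarith

theorem udist_le {r : II} {f g : CtsLatHom X II} (h : ∀ x, |(f x : ℝ) - g x| ≤ r) :
    udist f g ≤ r := by
  refine sup_le (sInf_le (leR_iff.2 fun x => ?_)) (sInf_le (leR_iff.2 fun x => ?_))
  all_goals
    have := abs_le.1 (h x)
    linarith

/-- A uniform limit of morphisms is a morphism. -/
def ofUniformApprox (F : X → II)
    (h : ∀ ε : ℝ, 0 < ε → ∃ g : CtsLatHom X II, ∀ x, |(F x : ℝ) - g x| ≤ ε) : CtsLatHom X II :=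
  have hm : Monotone F := fun x y hxy => le_of_forall_pos_le_add (α := ℝ) fun ε hε => by
    obtain ⟨g, hg⟩ := h (ε / 2) (half_pos hε)
    have h1 := abs_le.1 (hg x)
    have h2 := abs_le.1 (hg y)
    have h3 : (g x : ℝ) ≤ g y := g.monotone hxy
    linarith
  { toFun := F
    map_sInf' := fun s => by
      refine le_antisymm (le_sInf ?_) ?_
      · rintro _ ⟨x, hx, rfl⟩
        exact hm (sInf_le hx)
      · refine le_of_forall_pos_le_add (α := ℝ) fun ε hε => ?_
        obtain ⟨g, hg⟩ := h (ε / 2) (half_pos hε)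
        -- Lowering by `ε / 2` may leave the interval, so the value is truncated; the truncation
        -- only raises it here, since the infimum is at most 1.
        let c : II := Set.projIcc 0 1 zero_le_one ((sInf (F '' s) : II) - ε / 2)
        have hc : c ≤ g (sInf s) := by
          rw [g.map_sInf]
          refine le_sInf ?_
          rintro _ ⟨x, hx, rfl⟩
          have h1 := abs_le.1 (hg x)
          have h2 : ((sInf (F '' s) : II) : ℝ) ≤ F x :=
            (sInf_le (Set.mem_image_of_mem F hx) : sInf (F '' s) ≤ F x)
          refine (Set.monotone_projIcc _ (show _ ≤ (g x : ℝ) by linarith)).trans_eq ?_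
          exact Set.projIcc_val _ _
        have h1 := abs_le.1 (hg (sInf s))
        have h2 : (c : ℝ) ≤ g (sInf s) := hc
        have h3 : ((sInf (F '' s) : II) : ℝ) - ε / 2 ≤ c := by
          simp only [c, Set.coe_projIcc]
          refine le_max_of_le_right (le_min ?_ le_rfl)
          have := (sInf (F '' s)).2.2
          linarith
        linarith
    scottContinuous' := fun d hd hdir a ha => by
      refine ⟨?_, fun k hk => ?_⟩
      · rintro _ ⟨x, hx, rfl⟩
        exact hm (ha.1 hx)
      · refine le_of_forall_pos_le_add (α := ℝ) fun ε hε => ?_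
        obtain ⟨g, hg⟩ := h (ε / 2) (half_pos hε)
        let c : II := Set.projIcc 0 1 zero_le_one ((k : ℝ) + ε / 2)
        have hc : g a ≤ c := (g.scottContinuous hd hdir ha).2 (by
          rintro _ ⟨x, hx, rfl⟩
          have h1 := abs_le.1 (hg x)
          have h2 : (F x : ℝ) ≤ k := hk ⟨x, hx, rfl⟩
          refine (Set.projIcc_val zero_le_one (g x)).symm.trans_le ?_
          exact Set.monotone_projIcc _ (by linarith))
        have h1 := abs_le.1 (hg a)
        have h2 : (g a : ℝ) ≤ c := hc
        have h3 : (c : ℝ) ≤ k + ε / 2 := by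
          simp only [c, Set.coe_projIcc]
          refine max_le ?_ (min_le_right _ _)
          have := k.2.1
          linarith
        linarith }

end CtsLatHom

variable (X)

theorem isArchimedean_ctsDual : IsArchimedean (CtsLatHom X II) := fun f g h x =>
  le_of_forall_pos_le_add (α := ℝ) fun ε hε => by
    let r : II := ⟨min ε 1, le_min hε.le zero_le_one, min_le_right _ _⟩
    have hr : 0 < r := Subtype.coe_lt_coe.1 (lt_min hε zero_lt_one)
    have h1 := CtsLatHom.leR_iff.1 (h r hr) x
    have h2 : (r : ℝ) ≤ ε := min_le_left _ _
    linarith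

theorem isCauchyComplete_ctsDual : IsCauchyComplete (CtsLatHom X II) := by
  refine ⟨isArchimedean_ctsDual X, fun s hs => ?_⟩
  have hs' : ∀ ε : ℝ, 0 < ε → ∃ N, ∀ m ≥ N, ∀ n ≥ N, ∀ x, |(s m x : ℝ) - s n x| ≤ ε := by
    intro ε hε
    let r : II := ⟨min ε 1, le_min hε.le zero_le_one, min_le_right _ _⟩
    obtain ⟨N, hN⟩ := hs r (Subtype.coe_lt_coe.1 (lt_min hε zero_lt_one))
    exact ⟨N, fun m hm n hn x =>
      (CtsLatHom.abs_sub_le_of_udist_lt (hN m hm n hn) x).trans (min_le_left _ _)⟩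
  have hlim : ∀ x, ∃ l : II, Filter.Tendsto (fun n => s n x) Filter.atTop (nhds l) := by
    intro x
    refine cauchySeq_tendsto_of_complete (Metric.cauchySeq_iff.2 fun ε hε => ?_)
    obtain ⟨N, hN⟩ := hs' (ε / 2) (half_pos hε)
    exact ⟨N, fun m hm n hn => (hN m hm n hn x).trans_lt (half_lt_self hε)⟩
  choose F hF using hlim
  have hF' : ∀ ε : ℝ, 0 < ε → ∃ N, ∀ n ≥ N, ∀ x, |(s n x : ℝ) - F x| ≤ ε := by
    intro ε hε
    obtain ⟨N, hN⟩ := hs' ε hε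
    refine ⟨N, fun n hn x => ?_⟩
    have h1 : Filter.Tendsto (fun m => |(s n x : ℝ) - s m x|) Filter.atTop
        (nhds |(s n x : ℝ) - F x|) :=
      (tendsto_const_nhds.sub ((continuous_subtype_val.tendsto _).comp (hF x))).abs
    exact le_of_tendsto h1 (Filter.eventually_atTop.2 ⟨N, fun m hm => hN n hn m hm x⟩)
  refine ⟨CtsLatHom.ofUniformApprox F fun ε hε => ?_, fun ε hε => ?_⟩
  · obtain ⟨N, hN⟩ := hF' ε hε
    exact ⟨s N, fun x => by rw [abs_sub_comm]; exact hN N le_rfl x⟩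
  · obtain ⟨δ, hδ0, hδ⟩ := exists_between hε
    obtain ⟨N, hN⟩ := hF' δ hδ0
    exact ⟨N, fun n hn => (CtsLatHom.udist_le (hN n hn)).trans_lt hδ⟩

/-- Stacking is done pointwise in `[0,1]`. Since `p` and `q` jointly reflect order, the glued
function inherits preservation of meets and directed joins from its two coordinates. -/
theorem isStackable_ctsDual : IsStackable (CtsLatHom X II) := by
  have hle : ∀ {r : II} {p q : U}, RestrictsToIso p (Set.Icc 0 r) →
      RestrictsToIso q (Set.Icc r 1) → ∀ a b : CtsLatHom X II, p • a ≤ p • b → q • a ≤ q • b →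
      a ≤ b := fun hp hq _ _ h1 h2 x => le_of_split hp hq (h1 x) (h2 x)
  refine ⟨fun _ _ _ _ _ hp hq => hle hp hq, fun r _ _ p q hp hq f g hfg => ?_⟩
  have hx : ∀ x, 0 < g x → f x = 1 := fun x h0 => by
    by_contra h1
    have h1 : f x < 1 := lt_of_le_of_ne le_top h1
    -- These test maps send `g x` to 1 and `f x` to 0, so the hypothesis on all pairs would give `1
    -- ≤ 0`.
    have h2 : (U.ramp 0 (g x) h0 • g) x ≤ (U.ramp (f x) 1 h1 • f) x := hfg _ _ x
    rw [CtsLatHom.smul_apply, CtsLatHom.smul_apply, (U.ramp_eq_one h0).2 le_rfl,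
      (U.ramp_eq_zero h1).2 le_rfl] at h2
    exact not_lt.2 h2 zero_lt_one
  choose c hpc hqc using fun x => exists_split hp hq (hx x)
  have hc : Monotone c := fun x y hxy => le_of_split hp hq
    (by rw [hpc, hpc]; exact f.monotone hxy) (by rw [hqc, hqc]; exact g.monotone hxy)
  let C : CtsLatHom X II :=
    { toFun := c
      map_sInf' := fun s => by
        refine eq_of_split hp hq ?_ ?_
        · rw [hpc, map_sInf p, Set.image_image, f.map_sInf]
          simp only [hpc]
        · rw [hqc, map_sInf q, Set.image_image, g.map_sInf]
          simp only [hqc]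
      scottContinuous' := fun d hd hdir a ha => by
        refine ⟨?_, fun k hk => le_of_split hp hq ?_ ?_⟩
        · rintro _ ⟨x, hx, rfl⟩
          exact hc (ha.1 hx)
        · rw [hpc]
          refine (f.scottContinuous hd hdir ha).2 ?_
          rintro _ ⟨x, hx, rfl⟩
          rw [← hpc]
          exact p.monotone (hk ⟨x, hx, rfl⟩)
        · rw [hqc]
          refine (g.scottContinuous hd hdir ha).2 ?_
          rintro _ ⟨x, hx, rfl⟩
          rw [← hqc]
          exact q.monotone (hk ⟨x, hx, rfl⟩) }
  refine ⟨C, ⟨CtsLatHom.ext hpc, CtsLatHom.ext hqc⟩, ?_⟩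
  rintro D ⟨h1, h2⟩
  refine CtsLatHom.ext fun x => eq_of_split hp hq ?_ ?_
  · rw [← CtsLatHom.smul_apply, h1]
    exact (hpc x).symm
  · rw [← CtsLatHom.smul_apply, h2]
    exact (hqc x).symm

end CtsDual

/-! ### Continuous lattices: interpolation and the Urysohn lemma -/

section CtsLattice

variable {X : Type u} [CompleteLattice X]

namespace WayBelow

variable {x y z : X}

theorem le (h : WayBelow x y) : x ≤ y :=
  h (Order.Ideal.principal y) (le_sSup (Order.Ideal.mem_principal.2 le_rfl))

theorem trans_le (h : WayBelow x y) (hyz : y ≤ z) : WayBelow x z := fun I hI =>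
  h I (hyz.trans hI)

theorem le_trans (hxy : x ≤ y) (h : WayBelow y z) : WayBelow x z := fun I hI =>
  I.lower hxy (h I hI)

theorem bot (x : X) : WayBelow ⊥ x := fun I _ => I.bot_mem

theorem sup (h : WayBelow x z) (h' : WayBelow y z) : WayBelow (x ⊔ y) z := fun I hI =>
  I.sup_mem (h I hI) (h' I hI)

theorem exists_le {d : Set X} (hd : d.Nonempty) (hdir : DirectedOn (· ≤ ·) d) {a : X}
    (ha : IsLUB d a) (h : WayBelow x a) : ∃ y ∈ d, x ≤ y := by
  let I : Order.Ideal X :=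
    { carrier := {z | ∃ y ∈ d, z ≤ y}
      lower' := fun _ _ hab ⟨y, hy, hle⟩ => ⟨y, hy, hab.trans hle⟩
      nonempty' := hd.mono fun y hy => ⟨y, hy, le_rfl⟩
      directed' := by
        rintro a ⟨y, hy, hay⟩ b ⟨z, hz, hbz⟩
        obtain ⟨w, hw, hyw, hzw⟩ := hdir y hy z hz
        exact ⟨w, ⟨w, hw, le_rfl⟩, hay.trans hyw, hbz.trans hzw⟩ }
  exact h I (ha.2 fun y hy => le_sSup (a := y) ⟨y, hy, le_rfl⟩)

end WayBelow

theorem IsContinuousLattice.exists_wayBelow_not_le (hX : IsContinuousLattice X) {x z : X}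
    (h : ¬x ≤ z) : ∃ y, WayBelow y x ∧ ¬y ≤ z := by
  obtain ⟨I, hI, hx⟩ := hX x
  by_contra! H
  exact h (hx.trans (sSup_le fun y hy => H y (hI y hy)))

/-- The elements way below some member of the approximating ideal of `y` again form an ideal with
join above `y`, so `x` belongs to it. -/
theorem IsContinuousLattice.exists_between (hX : IsContinuousLattice X) {x y : X}
    (h : WayBelow x y) : ∃ z, WayBelow x z ∧ WayBelow z y := by
  obtain ⟨I, hI, hy⟩ := hX y
  let J : Order.Ideal X :=
    { carrier := {w | ∃ z ∈ I, WayBelow w z}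
      lower' := fun _ _ hab ⟨z, hz, hw⟩ => ⟨z, hz, hw.le_trans hab⟩
      nonempty' := ⟨⊥, ⊥, I.bot_mem, WayBelow.bot _⟩
      directed' := by
        rintro a ⟨z, hz, ha⟩ b ⟨z', hz', hb⟩
        exact ⟨a ⊔ b, ⟨z ⊔ z', I.sup_mem hz hz', (ha.trans_le le_sup_left).sup
          (hb.trans_le le_sup_right)⟩, le_sup_left, le_sup_right⟩ }
  obtain ⟨z, hz, hxz⟩ := h J (hy.trans (sSup_le fun z hz => by
    by_contra hn
    obtain ⟨w, hw, hwn⟩ := hX.exists_wayBelow_not_le hn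
    exact hwn (le_sSup (a := w) ⟨z, hz, hw⟩)))
  exact ⟨z, hxz, hI z hz⟩

/-- Dyadic refinement: `dyadicScale i x y n k` is the element assigned to `k / 2 ^ n`, where `i`
inserts an element between two given ones. -/
def dyadicScale {Y : Type u} (i : Y → Y → Y) (x y : Y) : ℕ → ℕ → Y
  | 0, k => if k = 0 then x else y
  | n + 1, k => if k % 2 = 0 then dyadicScale i x y n (k / 2)
      else i (dyadicScale i x y n (k / 2)) (dyadicScale i x y n (k / 2 + 1))

theorem dyadicScale_mul {Y : Type u} (i : Y → Y → Y) (x y : Y) (n k m : ℕ) :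
    dyadicScale i x y (n + m) (k * 2 ^ m) = dyadicScale i x y n k := by
  induction m with
  | zero => simp
  | succ m ih =>
    rw [← Nat.add_assoc, dyadicScale, pow_succ, ← mul_assoc, if_pos (Nat.mul_mod_left _ _),
      Nat.mul_div_cancel _ two_pos, ih]

theorem dyadicScale_wayBelow_succ {i : X → X → X}
    (hi : ∀ x y, WayBelow x y → WayBelow x (i x y) ∧ WayBelow (i x y) y) {x y : X}
    (h : WayBelow x y) (n k : ℕ) (hk : k < 2 ^ n) :
    WayBelow (dyadicScale i x y n k) (dyadicScale i x y n (k + 1)) := by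
  induction n generalizing k with
  | zero =>
    obtain rfl : k = 0 := by simpa using hk
    simpa [dyadicScale] using h
  | succ n ih =>
    rw [pow_succ] at hk
    have := hi _ _ (ih (k / 2) (by omega))
    rw [dyadicScale, dyadicScale]
    rcases Nat.mod_two_eq_zero_or_one k with h0 | h1
    · rw [if_pos h0, if_neg (by omega), show (k + 1) / 2 = k / 2 by omega]
      exact this.1
    · rw [if_neg (by omega), if_pos (by omega), show (k + 1) / 2 = k / 2 + 1 by omega]
      exact this.2

theorem dyadicScale_wayBelow {i : X → X → X}
    (hi : ∀ x y, WayBelow x y → WayBelow x (i x y) ∧ WayBelow (i x y) y) {x y : X}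
    (h : WayBelow x y) (n j k : ℕ) (hjk : j < k) (hk : k ≤ 2 ^ n) :
    WayBelow (dyadicScale i x y n j) (dyadicScale i x y n k) := by
  induction k, hjk using Nat.le_induction with
  | base => exact dyadicScale_wayBelow_succ hi h n j hk
  | succ k hjk ih =>
    exact (ih (by omega)).trans_le (dyadicScale_wayBelow_succ hi h n k hk).le

theorem exists_dyadic_between {s t : ℝ} (hs : 0 ≤ s) (hst : s < t) :
    ∃ n k : ℕ, s < k / 2 ^ n ∧ (k : ℝ) / 2 ^ n < t := by
  obtain ⟨n, hn⟩ := exists_pow_lt_of_lt_one (sub_pos.2 hst) (one_half_lt_one (α := ℝ))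
  have h2 : (0 : ℝ) < 2 ^ n := by positivity
  refine ⟨n, ⌊s * 2 ^ n⌋₊ + 1, ?_, ?_⟩
  · rw [lt_div_iff₀ h2]
    push_cast
    exact Nat.lt_floor_add_one _
  · have h1 := Nat.floor_le (show 0 ≤ s * 2 ^ n by positivity)
    rw [div_lt_iff₀ h2]
    push_cast
    rw [one_div, inv_pow, inv_lt_iff_one_lt_mul₀ h2] at hn
    linarith

/-- Between `x ≪ y` there is a scale of elements indexed by a dense subset of `[0,1]`. -/
theorem IsContinuousLattice.exists_scale (hX : IsContinuousLattice X) {x y : X}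
    (h : WayBelow x y) : ∃ S : II → X → Prop, S 1 y ∧ (∀ r g, S r g → 0 < r → x ≤ g) ∧
      (∀ r g r' g', S r g → S r' g' → r < r' → WayBelow g g') ∧
      ∀ r r', r < r' → ∃ t g, r < t ∧ t < r' ∧ S t g := by
  classical
  have hex : ∀ x y : X, ∃ z, WayBelow x y → WayBelow x z ∧ WayBelow z y := fun x y => by
    by_cases hxy : WayBelow x y
    · obtain ⟨z, hz⟩ := hX.exists_between hxy
      exact ⟨z, fun _ => hz⟩
    · exact ⟨x, fun h => absurd h hxy⟩
  choose i hi using hex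
  let G := dyadicScale i x y
  have key : ∀ n k n' k' : ℕ, k' ≤ 2 ^ n' → (k : ℝ) / 2 ^ n < k' / 2 ^ n' →
      WayBelow (G n k) (G n' k') := by
    intro n k n' k' hk' hlt
    -- Both fractions are rewritten over the common denominator `2 ^ (n + n')`.
    have e1 := dyadicScale_mul i x y n k n'
    have e2 := dyadicScale_mul i x y n' k' n
    rw [Nat.add_comm n' n] at e2
    simp only [G]
    rw [← e1, ← e2]
    refine dyadicScale_wayBelow hi h _ _ _ ?_ ?_
    · rw [div_lt_div_iff₀ (by positivity) (by positivity)] at hlt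
      exact_mod_cast hlt
    · rw [pow_add, mul_comm (2 ^ n)]
      exact Nat.mul_le_mul_right _ hk'
  refine ⟨fun r g => ∃ n k : ℕ, k ≤ 2 ^ n ∧ (r : ℝ) = k / 2 ^ n ∧ g = G n k, ?_, ?_, ?_, ?_⟩
  · exact ⟨0, 1, by simp, by simp, by simp [G, dyadicScale]⟩
  · rintro r _ ⟨n, k, hk, hr, rfl⟩ h0
    have h0 : (0 : ℝ) < r := h0
    have := key 0 0 n k hk (by rw [← hr]; simpa using h0)
    simpa [G, dyadicScale] using this.le
  · rintro r _ r' _ ⟨n, k, hk, hr, rfl⟩ ⟨n', k', hk', hr', rfl⟩ hlt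
    exact key n k n' k' hk' (by rw [← hr, ← hr']; exact hlt)
  · intro r r' hlt
    obtain ⟨n, k, h1, h2⟩ := exists_dyadic_between r.2.1 (show (r : ℝ) < r' from hlt)
    have h3 : (k : ℝ) / 2 ^ n ≤ 1 := h2.le.trans r'.2.2
    refine ⟨⟨k / 2 ^ n, by positivity, h3⟩, G n k, h1, h2, n, k, ?_, rfl, rfl⟩
    rw [div_le_one (by positivity)] at h3
    exact_mod_cast h3

/-- Urysohn's lemma for continuous lattices. -/
theorem IsContinuousLattice.urysohn (hX : IsContinuousLattice X) {x y : X} (h : WayBelow x y) :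
    ∃ f : CtsLatHom X II, f y = 1 ∧ ∀ z, 0 < f z → x ≤ z := by
  obtain ⟨S, h1, hx, hS, hd⟩ := hX.exists_scale h
  -- The largest label reached below `z`. For meets, slightly lowering the label gives one scale
  -- element below every member of the set; for directed joins, the lowered element is way below
  -- `a`, hence under a member of `d`.
  let F : X → II := fun z => sSup {r | ∃ g, S r g ∧ g ≤ z}
  have hF : ∀ {z r g}, S r g → g ≤ z → r ≤ F z := fun hr hg => le_sSup ⟨_, hr, hg⟩
  have hF' : ∀ {z t}, t < F z → ∃ r g, t < r ∧ S r g ∧ g ≤ z := fun {z t} ht => by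
    obtain ⟨r, ⟨g, hr, hg⟩, htr⟩ := lt_sSup_iff.1 ht
    exact ⟨r, g, htr, hr, hg⟩
  have hm : Monotone F := fun z z' hz => sSup_le_sSup fun r ⟨g, hr, hg⟩ => ⟨g, hr, hg.trans hz⟩
  refine ⟨{ toFun := F, map_sInf' := fun s => ?_, scottContinuous' := fun d hne hdir a ha => ?_ },
    ?_, fun z hz => ?_⟩
  · refine le_antisymm (le_sInf ?_) (le_of_forall_lt fun t ht => ?_)
    · rintro _ ⟨x, hx, rfl⟩
      exact hm (sInf_le hx)
    · obtain ⟨r, g, htr, hrL, hr⟩ := hd _ _ ht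
      refine htr.trans_le (hF hr (le_sInf fun z hz => ?_))
      obtain ⟨r', g', hrr', hr', hg'⟩ :=
        hF' (hrL.trans_le (sInf_le (Set.mem_image_of_mem F hz)))
      exact (hS _ _ _ _ hr hr' hrr').le.trans hg'
  · refine ⟨?_, fun k hk => le_of_forall_lt fun t ht => ?_⟩
    · rintro _ ⟨x, hx, rfl⟩
      exact hm (ha.1 hx)
    · obtain ⟨r', g', htr', hr', hg'⟩ := hF' ht
      obtain ⟨r, g, htr, hrr', hr⟩ := hd _ _ htr'
      obtain ⟨z, hz, hgz⟩ := ((hS _ _ _ _ hr hr' hrr').trans_le hg').exists_le hne hdir ha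
      exact htr.trans_le ((hF hr hgz).trans (hk ⟨z, hz, rfl⟩))
  · exact le_antisymm le_top (hF h1 le_rfl)
  · obtain ⟨r, g, h0, hr, hg⟩ := hF' hz
    exact (hx r g hr h0).trans hg

theorem IsContinuousLattice.le_of_forall_hom_le (hX : IsContinuousLattice X) {x z : X}
    (h : ∀ f : CtsLatHom X II, f x ≤ f z) : x ≤ z := by
  by_contra hn
  obtain ⟨y, hy, hyz⟩ := hX.exists_wayBelow_not_le hn
  obtain ⟨f, hf1, hf⟩ := hX.urysohn hy
  exact hyz (hf z (zero_lt_one.trans_le (hf1.ge.trans (h f))))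

/-! ### Evaluation is bijective -/

/-- Rescaling by `ramp 0 (φ a)` moves the value `φ a` to 1, so values equal to 1 carry all the
information. -/
theorem UMeetHom.le_of_forall_eq_one {A : Type u} [UMeetSemilattice A] {φ ψ : UMeetHom A II}
    (h : ∀ a, φ a = 1 → ψ a = 1) : φ ≤ ψ := by
  intro a
  rcases eq_or_lt_of_le (show 0 ≤ φ a from (φ a).2.1) with h0 | h0
  · exact h0.ge.trans (ψ a).2.1
  · have := h (U.ramp 0 (φ a) h0 • a) (by rw [φ.map_smul, smul_eq, U.ramp_eq_one])
    rwa [ψ.map_smul, smul_eq, U.ramp_eq_one] at this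

namespace CtsLatHom

/-- The least element at which `f` has value at least `s`. -/
def cut (f : CtsLatHom X II) (s : II) : X := sInf {z | s ≤ f z}

theorem cut_le {f : CtsLatHom X II} {s : II} {z : X} : f.cut s ≤ z ↔ s ≤ f z := by
  refine ⟨fun h => le_trans ?_ (f.monotone h), fun h => sInf_le h⟩
  rw [cut, f.map_sInf]
  exact le_sInf (by rintro _ ⟨z, hz, rfl⟩; exact hz)

theorem cut_mono (f : CtsLatHom X II) : Monotone f.cut := fun _ _ h =>
  cut_le.2 (h.trans (cut_le.1 le_rfl))

/-- The least point where `h` reaches 1 is the directed join of the least points where it reaches `s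
< 1`, and `f` preserves that join. -/
theorem exists_lt_apply_cut (f h : CtsLatHom X II) {r : II} (hr : r < f (h.cut 1)) :
    ∃ s < 1, r < f (h.cut s) := by
  have hlub : IsLUB (h.cut '' Set.Iio 1) (h.cut 1) := by
    refine ⟨?_, fun k hk => cut_le.2 (le_of_forall_lt_imp_le_of_dense fun s hs => ?_)⟩
    · rintro _ ⟨s, hs, rfl⟩
      exact h.cut_mono (le_of_lt hs)
    · exact cut_le.1 (hk ⟨s, hs, rfl⟩)
  have hdir : DirectedOn (· ≤ ·) (h.cut '' Set.Iio 1) := by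
    rintro _ ⟨s, hs, rfl⟩ _ ⟨t, ht, rfl⟩
    exact ⟨_, ⟨s ⊔ t, Set.mem_Iio.2 (sup_lt_iff.2 ⟨hs, ht⟩), rfl⟩, h.cut_mono le_sup_left,
      h.cut_mono le_sup_right⟩
  obtain ⟨_, ⟨_, ⟨s, hs, rfl⟩, rfl⟩, hlt⟩ := (lt_isLUB_iff
    (f.scottContinuous (Set.Nonempty.image _ ⟨0, Set.mem_Iio.2 zero_lt_one⟩) hdir hlub)).1 hr
  exact ⟨s, hs, hlt⟩

theorem eval_surjective : Function.Surjective (CtsLatHom.eval X) := by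
  intro φ
  let d : Set X := {z | ∃ h : CtsLatHom X II, φ h = 1 ∧ z = h.cut 1}
  have hne : d.Nonempty := ⟨_, ⊤, φ.map_top, rfl⟩
  have hdir : DirectedOn (· ≤ ·) d := by
    rintro _ ⟨h, hh, rfl⟩ _ ⟨h', hh', rfl⟩
    refine ⟨_, ⟨h ⊓ h', by rw [φ.map_inf, hh, hh', inf_idem], rfl⟩, ?_, ?_⟩
    all_goals
      have h1 : 1 ≤ h ((h ⊓ h').cut 1) ⊓ h' ((h ⊓ h').cut 1) := cut_le.1 (le_refl ((h ⊓ h').cut 1))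
      refine cut_le.2 (h1.trans ?_)
    · exact inf_le_left
    · exact inf_le_right
  refine ⟨sSup d, le_antisymm (UMeetHom.le_of_forall_eq_one fun f hf => ?_)
    (UMeetHom.le_of_forall_eq_one fun f hf => ?_)⟩
  · replace hf : f (sSup d) = 1 := hf
    refine le_antisymm le_top (le_of_forall_lt_imp_le_of_dense fun r hr => ?_)
    rcases eq_or_lt_of_le (show 0 ≤ r from r.2.1) with h0 | h0
    · rw [← h0]
      exact (φ f).2.1
    obtain ⟨_, ⟨_, ⟨h, hh, rfl⟩, rfl⟩, hlt⟩ := (lt_isLUB_iff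
      (f.scottContinuous hne hdir (isLUB_sSup d))).1 (hf.symm ▸ hr)
    obtain ⟨s, hs1, hlt⟩ := exists_lt_apply_cut f h hlt
    -- Where `h` reaches `s`, `f` exceeds `r`; elsewhere the left side vanishes. Applying `φ`, which
    -- is 1 at `h`, yields `r ≤ φ f`.
    have hle : U.ramp s 1 hs1 • h ≤ U.ramp 0 r h0 • f := fun z => by
      change U.ramp s 1 hs1 (h z) ≤ U.ramp 0 r h0 (f z)
      rcases le_total s (h z) with hz | hz
      · rw [(U.ramp_eq_one h0).2 (hlt.le.trans (f.monotone (cut_le.2 hz)))]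
        exact le_top
      · rw [(U.ramp_eq_zero hs1).2 hz]
        exact bot_le
    have := φ.monotone hle
    rw [φ.map_smul, φ.map_smul, hh, smul_eq, smul_eq, U.map_one] at this
    exact (U.ramp_eq_one h0).1 (le_antisymm le_top this)
  · exact le_antisymm le_top (cut_le.1 (le_sSup ⟨f, hf, rfl⟩))

end CtsLatHom

end CtsLattice

/-! ### Approximation of morphisms on the dual of a `U`-meet-semilattice -/

section Density

variable {A : Type u} [UMeetSemilattice A]

/-- The morphisms where `h` is 1 are those above `h.cut 1`, which is the join of its approximating
ideal; hence `h` is already positive at some member of that ideal, and the element `a` bounding this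
member, cut off at `r`, separates. -/
theorem exists_separating (h : CtsLatHom (UMeetHom A II) II) :
    ∃ a : A, (∀ φ : UMeetHom A II, h φ = 1 → φ a = 1) ∧ ∀ φ : UMeetHom A II, 0 < φ a → 0 < h φ := by
  have h1 : 1 ≤ h (sSup (UMeetHom.approxIdeal (h.cut 1) : Set (UMeetHom A II))) :=
    (CtsLatHom.cut_le.1 le_rfl).trans (h.monotone (UMeetHom.le_sSup_approxIdeal _))
  obtain ⟨_, ⟨ψ, ⟨a, r, h0, ha, hr, hψ⟩, rfl⟩, hlt⟩ := (lt_isLUB_iff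
    (h.scottContinuous (UMeetHom.approxIdeal (h.cut 1)).nonempty
      (UMeetHom.approxIdeal (h.cut 1)).directed (isLUB_sSup _))).1 (zero_lt_one.trans_le h1)
  refine ⟨U.ramp r 1 hr • a, fun φ hφ => ?_, fun φ hφ => ?_⟩
  · have : φ a = 1 := le_antisymm le_top (ha.ge.trans (CtsLatHom.cut_le.2 hφ.ge a))
    rw [φ.map_smul, this, smul_eq, U.map_one]
  · rw [φ.map_smul, smul_eq] at hφ
    have hra : r ≤ φ a := by
      by_contra! hlt
      rw [(U.ramp_eq_zero hr).2 hlt.le] at hφ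
      exact lt_irrefl _ hφ
    refine hlt.trans_le (h.monotone (hψ.trans (UMeetHom.leastAt_le ?_)))
    rwa [φ.map_smul, smul_eq, U.ramp_eq_one]

theorem exists_half : ∃ r : II, 0 < r ∧ r < 1 ∧ (r : ℝ) = 1 / 2 :=
  ⟨⟨1 / 2, by norm_num, by norm_num⟩, Subtype.coe_lt_coe.1 (by norm_num),
    Subtype.coe_lt_coe.1 (by norm_num), rfl⟩

theorem coe_eq_ramp_left {r : II} (h0 : 0 < r) (hr : (r : ℝ) = 1 / 2) {t : II}
    (ht : t ≤ r) : (t : ℝ) = U.ramp 0 r h0 t / 2 := by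
  rw [U.coe_ramp_of_mem h0 ⟨t.2.1, ht⟩, hr, Set.Icc.coe_zero]
  ring

theorem coe_eq_ramp_right {r : II} (h1 : r < 1) (hr : (r : ℝ) = 1 / 2) {t : II}
    (ht : r ≤ t) : (t : ℝ) = 1 / 2 + U.ramp r 1 h1 t / 2 := by
  rw [U.coe_ramp_of_mem h1 ⟨ht, t.2.2⟩, hr, Set.Icc.coe_one]
  ring

theorem abs_sub_le_half_of_ramp {r : II} (h0 : 0 < r) (h1 : r < 1) (hr : (r : ℝ) = 1 / 2)
    {s t : II} {δ : ℝ} (hp : |(U.ramp 0 r h0 s : ℝ) - U.ramp 0 r h0 t| ≤ δ)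
    (hq : |(U.ramp r 1 h1 s : ℝ) - U.ramp r 1 h1 t| ≤ δ)
    (h : s ≤ r ∧ t ≤ r ∨ r ≤ s ∧ r ≤ t) : |(s : ℝ) - t| ≤ δ / 2 := by
  rcases h with ⟨hs, ht⟩ | ⟨hs, ht⟩
  · rw [coe_eq_ramp_left h0 hr hs, coe_eq_ramp_left h0 hr ht, ← sub_div,
      abs_div, abs_two]
    gcongr
  · rw [coe_eq_ramp_right h1 hr hs, coe_eq_ramp_right h1 hr ht,
      add_sub_add_left_eq_sub, ← sub_div, abs_div, abs_two]
    gcongr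

/-- Morphisms on the dual are uniformly approximated by evaluations. -/
theorem exists_uniform_approx (hA : IsArchimedean A) (hS : IsStackable A) (n : ℕ)
    (h : CtsLatHom (UMeetHom A II) II) :
    ∃ a : A, (∀ φ : UMeetHom A II, h φ = 1 → φ a = 1) ∧
      (∀ φ : UMeetHom A II, 0 < φ a → 0 < h φ) ∧
      ∀ φ : UMeetHom A II, |(h φ : ℝ) - φ a| ≤ (1 / 2) ^ n := by
  induction n generalizing h with
  | zero =>
    obtain ⟨a, h1, h2⟩ := exists_separating h
    refine ⟨a, h1, h2, fun φ => ?_⟩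
    rw [pow_zero, abs_le]
    have := (h φ).2.1
    have := (h φ).2.2
    have := (φ a).2.1
    have := (φ a).2.2
    constructor <;> linarith
  | succ n ih =>
    -- The lower and upper halves of `h` are approximated separately and stacked, which halves the
    -- error. The two conditions on the values 0 and 1 make the pieces compatible: where `b` is
    -- positive, `h > 1/2`, so `a` is 1.
    obtain ⟨r, hr0, hr1, hr⟩ := exists_half
    obtain ⟨a, ha1, ha0, ha⟩ := ih (U.ramp 0 r hr0 • h)
    obtain ⟨b, hb1, hb0, hb⟩ := ih (U.ramp r 1 hr1 • h)
    simp only [CtsLatHom.smul_apply] at ha1 ha0 ha hb1 hb0 hb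
    have hb0' : ∀ φ : UMeetHom A II, 0 < φ b → r < h φ := fun φ hφ => by
      by_contra! hle
      exact (hb0 φ hφ).ne' ((U.ramp_eq_zero hr1).2 hle)
    have hab : ∀ p q : U, q • b ≤ p • a := fun p q =>
      le_of_forall_hom_le hA hS.1 fun φ => by
        rw [φ.map_smul, φ.map_smul, smul_eq, smul_eq]
        rcases eq_or_lt_of_le (show 0 ≤ φ b from (φ b).2.1) with h0 | h0
        · rw [← h0, U.map_zero]
          exact (p (φ a)).2.1
        · rw [ha1 φ ((U.ramp_eq_one hr0).2 (hb0' φ h0).le), U.map_one]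
          exact (q (φ b)).2.2
    obtain ⟨c, ⟨hca, hcb⟩, -⟩ := hS.2 r hr0 hr1 _ _ (restrictsToIso_ramp_left hr0)
      (restrictsToIso_ramp_right hr1) a b hab
    have hca' : ∀ φ : UMeetHom A II, U.ramp 0 r hr0 (φ c) = φ a := fun φ => by
      rw [← hca, φ.map_smul, smul_eq]
    have hcb' : ∀ φ : UMeetHom A II, U.ramp r 1 hr1 (φ c) = φ b := fun φ => by
      rw [← hcb, φ.map_smul, smul_eq]
    refine ⟨c, fun φ hφ => ?_, fun φ hφ => ?_, fun φ => ?_⟩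
    · have := hb1 φ (by rw [hφ, U.map_one])
      rw [← hcb', U.ramp_eq_one] at this
      exact le_antisymm le_top this
    · by_contra! hle
      have h0 : h φ = 0 := le_antisymm hle (h φ).2.1
      have h1 : φ a ≤ 0 := by
        by_contra! hlt
        exact (ha0 φ hlt).ne' (by rw [h0, U.map_zero])
      have h2 := (hca' φ).trans (le_antisymm h1 (φ a).2.1)
      rw [U.ramp_eq_zero] at h2
      exact not_lt.2 h2 hφ
    · rw [pow_succ, mul_one_div]
      refine abs_sub_le_half_of_ramp hr0 hr1 hr (by rw [hca']; exact ha φ)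
        (by rw [hcb']; exact hb φ) ?_
      -- The same conditions put `h φ` and `φ c` on the same side of `1/2`, so only one half
      -- contributes to the error.
      rcases le_total (h φ) r with hle | hle
      · refine Or.inl ⟨hle, ?_⟩
        rw [← U.ramp_eq_zero hr1, hcb']
        by_contra hne
        exact not_lt.2 hle (hb0' φ (lt_of_le_of_ne (φ b).2.1 (Ne.symm hne)))
      · refine Or.inr ⟨hle, ?_⟩
        rw [← U.ramp_eq_one hr0, hca']
        exact ha1 φ ((U.ramp_eq_one hr0).2 hle)

namespace UMeetHom

theorem leR_iff_of_forall_hom_le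
    (hA : ∀ {a b : A}, (∀ φ : UMeetHom A II, φ a ≤ φ b) → a ≤ b) {r : II} {a b : A} :
    LeR r a b ↔ LeR r (eval A a) (eval A b) := by
  refine ⟨fun h p q hpq => ?_, fun h p q hpq => hA fun φ => ?_⟩
  · rw [← (eval A).map_smul, ← (eval A).map_smul]
    exact (eval A).monotone (h p q hpq)
  · rw [φ.map_smul, φ.map_smul]
    exact h p q hpq φ

theorem eval_surjective (hA : IsCauchyComplete A) (hS : IsStackable A) :
    Function.Surjective (eval A) := by
  intro h
  have hle : ∀ {a b : A}, (∀ φ : UMeetHom A II, φ a ≤ φ b) → a ≤ b :=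
    le_of_forall_hom_le hA.1 hS.1
  -- As morphisms detect the order, evaluation preserves and reflects each relation `LeR r`, so
  -- uniform estimates on the dual are distance estimates in `A`.
  have hdist : ∀ a b : A, udist a b = udist (eval A a) (eval A b) := fun a b => by
    simp only [udist, rho, leR_iff_of_forall_hom_le hle]
  choose s _ _ hs using fun n => exists_uniform_approx hA.1 hS n h
  have hsmall : ∀ ε : ℝ, 0 < ε → ∃ N, ∀ n ≥ N, ∀ φ : UMeetHom A II,
      |(h φ : ℝ) - φ (s n)| ≤ ε := by
    intro ε hε
    obtain ⟨N, hN⟩ := exists_pow_lt_of_lt_one hε (one_half_lt_one (α := ℝ))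
    exact ⟨N, fun n hn φ => (hs n φ).trans
      ((pow_le_pow_of_le_one (by norm_num) (by norm_num) hn).trans hN.le)⟩
  obtain ⟨a, ha⟩ := hA.2 s fun ε hε => by
    obtain ⟨δ, hδ0, hδ⟩ := exists_between hε
    have hδ0' : (0 : ℝ) < δ := hδ0
    obtain ⟨N, hN⟩ := hsmall (δ / 2) (half_pos hδ0')
    refine ⟨N, fun m hm n hn => lt_of_le_of_lt ?_ hδ⟩
    rw [hdist]
    refine CtsLatHom.udist_le fun φ => ?_
    have h1 := abs_le.1 (hN m hm φ)
    have h2 := abs_le.1 (hN n hn φ)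
    change |(φ (s m) : ℝ) - φ (s n)| ≤ δ
    rw [abs_le]
    constructor <;> linarith
  refine ⟨a, CtsLatHom.ext fun φ => eq_of_forall_dist_le fun ε hε => ?_⟩
  obtain ⟨N, hN⟩ := hsmall (ε / 2) (half_pos hε)
  let r : II := ⟨min (ε / 2) 1, le_min (half_pos hε).le zero_le_one, min_le_right _ _⟩
  obtain ⟨N', hN'⟩ := ha r (Subtype.coe_lt_coe.1 (lt_min (half_pos hε) zero_lt_one))
  have h1 := abs_le.1 (hN (max N N') (le_max_left _ _) φ)
  have h2 := hN' (max N N') (le_max_right _ _)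
  rw [hdist] at h2
  have h3 : |(φ (s (max N N')) : ℝ) - φ a| ≤ r := CtsLatHom.abs_sub_le_of_udist_lt h2 φ
  have h4 := abs_le.1 (h3.trans (min_le_left _ _))
  change |(φ a : ℝ) - h φ| ≤ ε
  rw [abs_le]
  constructor <;> linarith

end UMeetHom

end Density

/-! ### Inverses of bijective morphisms -/

/-- A morphism of `U`-meet-semilattices that is bijective has an inverse morphism. -/
noncomputable def UMeetHom.inverse {A : Type u} {B : Type v} [UMeetSemilattice A]
    [UMeetSemilattice B] (f : UMeetHom A B) (hf : Function.Bijective f) : UMeetHom B A where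
  toFun := Function.surjInv hf.2
  map_inf' a b := hf.1 (by simp only [f.map_inf, Function.surjInv_eq hf.2])
  map_top' := hf.1 (by simp only [f.map_top, Function.surjInv_eq hf.2])
  map_smul' p a := hf.1 (by
    simp only [f.map_smul, Function.surjInv_eq hf.2])

/-- A morphism of complete lattices that is surjective and reflects the order has an inverse
morphism. -/
noncomputable def CtsLatHom.inverse {X : Type u} {Y : Type v} [CompleteLattice X]
    [CompleteLattice Y] (f : CtsLatHom X Y) (hf : Function.Surjective f)
    (hle : ∀ {x x'}, f x ≤ f x' → x ≤ x') : CtsLatHom Y X where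
  toFun := Function.surjInv hf
  map_sInf' s := by
    have h : f (Function.surjInv hf (sInf s)) = f (sInf (Function.surjInv hf '' s)) := by
      simp only [f.map_sInf, Set.image_image, Function.surjInv_eq hf, Set.image_id']
    exact le_antisymm (hle h.le) (hle h.ge)
  scottContinuous' d _ _ a ha := by
    refine ⟨?_, fun k hk => hle ?_⟩
    · rintro _ ⟨y, hy, rfl⟩
      refine hle ?_
      rw [Function.surjInv_eq hf, Function.surjInv_eq hf]
      exact ha.1 hy
    · rw [Function.surjInv_eq hf]
      refine ha.2 fun y hy => ?_
      rw [← Function.surjInv_eq hf y]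
      exact f.monotone (hk ⟨y, hy, rfl⟩)

theorem CStUMeet.isIso_of_bijective {A B : CStUMeet.{u}} (f : A ⟶ B)
    (hf : Function.Bijective (show UMeetHom A B from f)) : IsIso f :=
  ⟨UMeetHom.inverse (show UMeetHom A B from f) hf,
    UMeetHom.ext fun _ => hf.1 (Function.surjInv_eq hf.2 _),
    UMeetHom.ext fun b => Function.surjInv_eq hf.2 b⟩

theorem CtsLat.isIso_of_surjective {X Y : CtsLat.{u}} (f : X ⟶ Y)
    (hf : Function.Surjective (show CtsLatHom X Y from f))
    (hle : ∀ {x x' : X}, (show CtsLatHom X Y from f) x ≤ (show CtsLatHom X Y from f) x' →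
      x ≤ x') : IsIso f :=
  ⟨CtsLatHom.inverse (show CtsLatHom X Y from f) hf hle,
    CtsLatHom.ext fun _ => le_antisymm (hle (Function.surjInv_eq hf _).le)
      (hle (Function.surjInv_eq hf _).ge),
    CtsLatHom.ext fun y => Function.surjInv_eq hf y⟩

/-! ### The dual adjunction -/

theorem ctsDual_spec (X : CtsLat.{u}) :
    IsCauchyComplete (CtsLatHom X II) ∧ IsStackable (CtsLatHom X II) :=
  ⟨isCauchyComplete_ctsDual X, isStackable_ctsDual X⟩

theorem uDual_spec (A : CStUMeet.{u}) : IsContinuousLattice (UMeetHom A II) :=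
  isContinuousLattice_uDual A

/-- The dual adjunction, with the evaluation maps as unit and counit. -/
noncomputable def dualAdjunction :
    (uDual.{u} uDual_spec).rightOp ⊣ ctsDual.{u} ctsDual_spec where
  unit :=
    { app := fun A => UMeetHom.eval A
      naturality := fun _ _ _ => rfl }
  counit :=
    { app := fun X => Quiver.Hom.op (CtsLatHom.eval X.unop :)
      naturality := fun _ _ _ => rfl }
  left_triangle_components _ := rfl
  right_triangle_components _ := rfl

instance (A : CStUMeet.{u}) : IsIso (dualAdjunction.unit.app A) := by
  refine CStUMeet.isIso_of_bijective _ ⟨fun a b h => ?_,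
    UMeetHom.eval_surjective A.isComplete A.isStackable⟩
  have h' : ∀ φ : UMeetHom A II, φ a = φ b := fun φ =>
    congrArg (fun F : CtsLatHom (UMeetHom A II) II => F φ) h
  exact le_antisymm
    (le_of_forall_hom_le A.isComplete.1 A.isStackable.1 fun φ => (h' φ).le)
    (le_of_forall_hom_le A.isComplete.1 A.isStackable.1 fun φ => (h' φ).ge)

instance (X : CtsLat.{u}ᵒᵖ) : IsIso (dualAdjunction.counit.app X) := by
  have : IsIso (dualAdjunction.counit.app X).unop :=
    CtsLat.isIso_of_surjective _ CtsLatHom.eval_surjective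
      fun h => X.unop.isContinuous.le_of_forall_hom_le h
  exact (isIso_unop_iff _).1 this

end CtsDuality

theorem mainTheorem10 :
    ∃ (hX : ∀ X : CtsDuality.CtsLat.{u},
          CtsDuality.IsCauchyComplete (CtsDuality.CtsLatHom X CtsDuality.II) ∧
          CtsDuality.IsStackable (CtsDuality.CtsLatHom X CtsDuality.II))
      (hA : ∀ A : CtsDuality.CStUMeet.{u},
          CtsDuality.IsContinuousLattice (CtsDuality.UMeetHom A CtsDuality.II))
      (adj : (CtsDuality.uDual hA).rightOp ⊣ CtsDuality.ctsDual hX),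
      -- the unit and the counit of the adjunction are the evaluation maps
      (∀ A : CtsDuality.CStUMeet.{u}, adj.unit.app A = CtsDuality.UMeetHom.eval A) ∧
      (∀ X : CtsDuality.CtsLat.{u},
        adj.counit.app (op X) = Quiver.Hom.op (CtsDuality.CtsLatHom.eval X)) ∧
      -- and both functors are equivalences
      (CtsDuality.ctsDual hX).IsEquivalence ∧
      (CtsDuality.uDual hA).IsEquivalence := by
  have h1 : (CtsDuality.uDual CtsDuality.uDual_spec.{u}).rightOp.IsEquivalence :=
    CtsDuality.dualAdjunction.{u}.toEquivalence.isEquivalence_functor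
  exact ⟨CtsDuality.ctsDual_spec, CtsDuality.uDual_spec, CtsDuality.dualAdjunction,
    fun _ => rfl, fun _ => rfl,
    CtsDuality.dualAdjunction.{u}.toEquivalence.isEquivalence_inverse,
    -- The adjunction gives the equivalence for `rightOp`; passing to `leftOp` recovers `uDual`
    -- itself.
    inferInstanceAs (CtsDuality.uDual CtsDuality.uDual_spec.{u}).rightOp.leftOp.IsEquivalence⟩
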